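/- Let $T_1,T_2$ be commuting contractions on a complex Hilbert space $\mathcal H$ and $T=T_1T_2$. For a contraction $S$ put $D_S=(I-S^*S)^{1/2}$ and $\mathcal D_S=\overline{\operatorname{Ran}}\,D_S$. For a Hilbert space $\mathcal F$, $H^2(\mathcal F)=H^2\otimes\mathcal F$ is the $\mathcal F$-valued Hardy space of the unit disk, and $M_\varphi$ denotes multiplication by $\varphi$ on it. **Andô tuples.** An Andô tuple $(\mathcal F,\Lambda,P,U)$ of $(T_1,T_2)$ consists of $\mathcal F=\mathcal D_{T_1}\oplus(\mathcal D_{T_2}\oplus E)$ with an auxiliary Hilbert space $E$ (for instance $E=0$ or $E=\ell^2$), the isometry $\Lambda:\mathcal D_T\to\mathcal F$ with $\Lambda D_Th=D_{T_1}T_2h\oplus D_{T_2}h$ for $h\in\mathcal H$, the orthogonal projection $P$ of $\mathcal F$ onto $\mathcal D_{T_1}$, and a unitary $U$ on $\mathcal F$ with $U(D_{T_1}T_2h\oplus D_{T_2}h)=D_{T_1}h\oplus D_{T_2}T_1h$ for $h\in\mathcal H$. Write $P^\perp=I-P$. **Schäffer-type dilation.** Given an Andô tuple $(\mathcal F,\Lambda,P,U)$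 of $(T_1,T_2)$, define on $\mathcal H\oplus H^2(\mathcal F)$ $$V_1^S=\begin{pmatrix}T_1&0\\ PU\Lambda D_T&M_{P^\perp U+zPU}\end{pmatrix},\qquad V_2^S=\begin{pmatrix}T_2&0\\ U^*P^\perp\Lambda D_T&M_{U^*P+zU^*P^\perp}\end{pmatrix},$$ where the $(2,1)$ entries take values in the constant functions, and let $\Pi_\Lambda=I_{\mathcal H}\oplus(I_{H^2}\otimes\Lambda):\mathcal H\oplus H^2(\mathcal D_T)\to\mathcal H\oplus H^2(\mathcal F)$. **Douglas-type dilation.** Let $Q\ge 0$ be the operator with $Q^2=\lim_n T^nT^{*n}$ in the strong operator topology. For $i=1,2$ let $X_i^*$ be the bounded operator on $\overline{\operatorname{Ran}}\,Q$ determined by $X_i^*Q=QT_i^*$. A residual part consists of a Hilbert space $\mathcal R\supseteq\overline{\operatorname{Ran}}\,Q$ and commuting unitaries $W_1,W_2$ on $\mathcal R$ such that $W_i^*$ extends $X_i^*$ for $i=1,2$, and $W^*=(W_1W_2)^*$ is the minimal unitary extension of the isometry $X^*=X_1^*X_2^*$. Given a residual part and an Andô tuple $(\mathcal F_*,\Gamma,P',U')$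 of $(T_1^*,T_2^*)$, define on $H^2(\mathcal F_*)\oplus\mathcal R$ $$V_1^D=M_{U'^*P'^\perp+zU'^*P'}\oplus W_1,\qquad V_2^D=M_{P'U'+zP'^\perp U'}\oplus W_2,$$ and let $\Pi_\Gamma=(I_{H^2}\otimes\Gamma)\oplus I_{\mathcal R}:H^2(\mathcal D_{T^*})\oplus\mathcal R\to H^2(\mathcal F_*)\oplus\mathcal R$. **Theorem.** Andô tuples of $(T_1,T_2)$ and of $(T_1^*,T_2^*)$ and a residual part always exist, and for every choice of them $$\Pi_\Lambda^*\,(V_1^S,\,V_2^S,\,V_1^SV_2^S)\,\Pi_\Lambda\quad\text{is unitarily equivalent to}\quad \Pi_\Gamma^*\,(V_1^D,\,V_2^D,\,V_1^DV_2^D)\,\Pi_\Gamma,$$ that is, there is one unitary $\tau:\mathcal H\oplus H^2(\mathcal D_T)\to H^2(\mathcal D_{T^*})\oplus\mathcal R$ that intertwines all three pairs of corresponding compressed operators. -/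

import Mathlib

open scoped InnerProduct ENNReal
open Filter Topology

universe u v w v₁ v₂

namespace Ando

noncomputable section

/-! ### Vector-valued Hardy spaces -/

/-- The Hardy space `H²(F)`: an `F`-valued analytic function `f(z) = ∑ zⁿ fₙ` on the unit disk whose
Taylor coefficients are norm-square summable is represented by the sequence `(fₙ)` of its
coefficients, i.e. `H²(F) = H² ⊗ F = ℓ²(ℕ; F)`. -/
abbrev H2 (F : Type*) [NormedAddCommGroup F] : Type _ := lp (fun _ : ℕ => F) 2

namespace H2

variable {F G : Type*} [NormedAddCommGroup F] [NormedAddCommGroup G]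

theorem summable_sq (f : H2 F) : Summable fun n => ‖f n‖ ^ 2 := by
  have := (lp.memℓp f).summable (by norm_num)
  simpa using this

theorem memlp_of_summable {f : ℕ → F} (hf : Summable fun n => ‖f n‖ ^ 2) :
    Memℓp (E := fun _ : ℕ => F) f 2 := by
  refine memℓp_gen ?_
  simpa using hf

theorem norm_sq (f : H2 F) : ‖f‖ ^ 2 = ∑' n, ‖f n‖ ^ 2 := by
  have := lp.norm_rpow_eq_tsum (p := 2) (by norm_num) f
  simpa using this

/-- The coefficients of `z f(z)`. -/
def shiftFun (f : ℕ → F) : ℕ → F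
  | 0 => 0
  | n + 1 => f n

theorem summable_shift (f : H2 F) : Summable fun n => ‖shiftFun f n‖ ^ 2 :=
  (summable_nat_add_iff 1).1 (summable_sq f)

variable [InnerProductSpace ℂ F] [InnerProductSpace ℂ G]

/-- The value `f(z) = ∑ zⁿ fₙ` of `f ∈ H²(F)` at a point `z` of the open unit disk. -/
def eval (f : H2 F) (z : ℂ) : F := ∑' n : ℕ, z ^ n • f n

theorem summable_map (A : F →L[ℂ] G) (f : H2 F) : Summable fun n => ‖A (f n)‖ ^ 2 := by
  refine Summable.of_nonneg_of_le (fun n => by positivity) (fun n => ?_)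
    ((summable_sq f).mul_left (‖A‖ ^ 2))
  rw [← mul_pow]
  gcongr
  exact A.le_opNorm _

/-- The operator `I_{H²} ⊗ A : H²(F) → H²(G)`, acting coefficientwise by `A : F → G`. -/
def map (A : F →L[ℂ] G) : H2 F →L[ℂ] H2 G :=
  LinearMap.mkContinuous
    { toFun := fun f => ⟨fun n => A (f n), memlp_of_summable (summable_map A f)⟩
      map_add' := fun f g => by
        ext n
        exact map_add A (f n) (g n)
      map_smul' := fun c f => by
        ext n
        exact map_smul A c (f n) }
    ‖A‖ (fun f => by
      refine le_of_sq_le_sq ?_ (by positivity)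
      rw [mul_pow, norm_sq, norm_sq, ← tsum_mul_left]
      refine (summable_map A f).tsum_le_tsum (fun n => ?_) ((summable_sq f).mul_left _)
      rw [← mul_pow]
      gcongr
      exact A.le_opNorm _)

@[simp] theorem map_apply (A : F →L[ℂ] G) (f : H2 F) (n : ℕ) : map A f n = A (f n) := rfl

/-- The forward shift `M_z` on `H²(F)`. -/
def shift : H2 F →L[ℂ] H2 F :=
  LinearMap.mkContinuous
    { toFun := fun f => ⟨shiftFun f, memlp_of_summable (summable_shift f)⟩
      map_add' := fun f g => by
        ext n
        cases n with
        | zero => exact (add_zero (0 : F)).symm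
        | succ n => rfl
      map_smul' := fun c f => by
        ext n
        cases n with
        | zero => exact (smul_zero c).symm
        | succ n => rfl }
    1 (fun f => by
      refine le_of_sq_le_sq ?_ (by positivity)
      rw [one_mul, norm_sq, norm_sq]
      refine le_of_eq ?_
      refine ((summable_shift f).tsum_eq_zero_add).trans ?_
      simp [shiftFun])

@[simp] theorem shift_zero (f : H2 F) : shift f 0 = 0 := rfl

@[simp] theorem shift_succ (f : H2 F) (n : ℕ) : shift f (n + 1) = f n := rfl

/-- The embedding `F → H²(F)` of `F` as the constant functions. -/
def const : F →L[ℂ] H2 F := lp.singleContinuousLinearMap ℂ (fun _ : ℕ => F) 2 0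

/-- The multiplication operator `M_φ` on `H²(F)` with the symbol `φ(z) = A + z B`. -/
def mulOp (A B : F →L[ℂ] F) : H2 F →L[ℂ] H2 F := map A + shift ∘L map B

theorem summable_eval [CompleteSpace F] (f : H2 F) {z : ℂ} (hz : ‖z‖ < 1) :
    Summable fun n : ℕ => z ^ n • f n := by
  refine Summable.of_norm_bounded
    ((summable_geometric_of_lt_one (norm_nonneg z) hz).mul_right ‖f‖) (fun n => ?_)
  rw [norm_smul, norm_pow]
  gcongr
  exact lp.norm_apply_le_norm (by norm_num) f n

/-- `mulOp A B` is the pointwise multiplication `(M_φ f)(z) = φ(z) f(z)`, for `φ(z) = A + z B`. -/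
theorem eval_mulOp [CompleteSpace F] (A B : F →L[ℂ] F) (f : H2 F) {z : ℂ} (hz : ‖z‖ < 1) :
    eval (mulOp A B f) z = (A + z • B) (eval f z) := by
  have hA : eval (map A f) z = A (eval f z) := by
    simp only [eval, A.map_tsum (summable_eval f hz), map_apply, map_smul]
  have hB : eval (shift (map B f)) z = z • B (eval f z) := by
    rw [eval, (summable_eval _ hz).tsum_eq_zero_add]
    simp only [eval, B.map_tsum (summable_eval f hz), shift_zero, shift_succ, map_apply, map_smul,
      smul_zero, zero_add]
    rw [← tsum_const_smul'' z]
    simp only [smul_smul, pow_succ']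
  have hsum : eval (mulOp A B f) z = eval (map A f) z + eval (shift (map B f)) z := by
    rw [eval, eval, eval, ← (summable_eval _ hz).tsum_add (summable_eval _ hz)]
    simp only [← smul_add]
    rfl
  rw [hsum, hA, hB]
  rfl

end H2

/-! ### Block operators on Hilbert space direct sums -/

/-- The block operator matrix `(A B; C D) : K₁ ⊕ K₂ → L₁ ⊕ L₂` between Hilbert space direct sums. -/
def blockOp {K₁ K₂ L₁ L₂ : Type*}
    [NormedAddCommGroup K₁] [InnerProductSpace ℂ K₁] [NormedAddCommGroup K₂]
    [InnerProductSpace ℂ K₂] [NormedAddCommGroup L₁] [InnerProductSpace ℂ L₁]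
    [NormedAddCommGroup L₂] [InnerProductSpace ℂ L₂]
    (A : K₁ →L[ℂ] L₁) (B : K₂ →L[ℂ] L₁) (C : K₁ →L[ℂ] L₂) (D : K₂ →L[ℂ] L₂) :
    WithLp 2 (K₁ × K₂) →L[ℂ] WithLp 2 (L₁ × L₂) :=
  (WithLp.prodContinuousLinearEquiv 2 ℂ L₁ L₂).symm.toContinuousLinearMap ∘L
    ((A.coprod B).prod (C.coprod D)) ∘L
      (WithLp.prodContinuousLinearEquiv 2 ℂ K₁ K₂).toContinuousLinearMap

theorem blockOp_toLp {K₁ K₂ L₁ L₂ : Type*}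
    [NormedAddCommGroup K₁] [InnerProductSpace ℂ K₁] [NormedAddCommGroup K₂]
    [InnerProductSpace ℂ K₂] [NormedAddCommGroup L₁] [InnerProductSpace ℂ L₁]
    [NormedAddCommGroup L₂] [InnerProductSpace ℂ L₂]
    (A : K₁ →L[ℂ] L₁) (B : K₂ →L[ℂ] L₁) (C : K₁ →L[ℂ] L₂) (D : K₂ →L[ℂ] L₂) (x : K₁) (y : K₂) :
    blockOp A B C D (WithLp.toLp 2 (x, y)) = WithLp.toLp 2 (A x + B y, C x + D y) := rfl

/-! ### Unitary equivalence and compressions -/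

/-- Two tuples of bounded operators are unitarily equivalent if one and the same unitary intertwines
all their entries. -/
def UnitarilyEquivalent {n : ℕ} {K : Type*} {L : Type*}
    [NormedAddCommGroup K] [InnerProductSpace ℂ K] [NormedAddCommGroup L] [InnerProductSpace ℂ L]
    (A : Fin n → K →L[ℂ] K) (B : Fin n → L →L[ℂ] L) : Prop :=
  ∃ τ : K ≃ₗᵢ[ℂ] L, ∀ i x, τ (A i x) = B i (τ x)

/-- The triple `J* (V₁, V₂, V₁V₂) J`. -/
def compressedTriple {K L : Type*} [NormedAddCommGroup K] [InnerProductSpace ℂ K] [CompleteSpace K]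
    [NormedAddCommGroup L] [InnerProductSpace ℂ L] [CompleteSpace L]
    (V₁ V₂ : L →L[ℂ] L) (J : K →L[ℂ] L) : Fin 3 → K →L[ℂ] K :=
  ![J† ∘L V₁ ∘L J, J† ∘L V₂ ∘L J, J† ∘L (V₁ * V₂) ∘L J]

variable {H : Type u} [NormedAddCommGroup H] [InnerProductSpace ℂ H] [CompleteSpace H]

/-! ### Defect operators -/

/-- The defect operator `D_T = (I - T*T)^{1/2}` of a contraction `T`. -/
def defect (T : H →L[ℂ] H) : H →L[ℂ] H := CFC.sqrt (1 - T† * T)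

/-- The defect space `𝒟_T`, the closure of the range of `D_T`. -/
abbrev defectSpace (T : H →L[ℂ] H) : Submodule ℂ H := (defect T).range.topologicalClosure

/-- The defect operator `D_T`, as an operator from `H` to `𝒟_T`. -/
def defectTo (T : H →L[ℂ] H) : H →L[ℂ] defectSpace T :=
  (defect T).codRestrict (defectSpace T)
    (fun h => Submodule.le_topologicalClosure _ (LinearMap.mem_range_self _ h))

/-! ### Andô tuples -/

/-- The Hilbert space `𝒟_{T₁} ⊕ (𝒟_{T₂} ⊕ E)`. -/
abbrev AndoSpace (T₁ T₂ : H →L[ℂ] H) (E : Type v) [NormedAddCommGroup E] : Type (max u v) :=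
  WithLp 2 (defectSpace T₁ × WithLp 2 (defectSpace T₂ × E))

/-- The vector `f ⊕ g ⊕ 0` of `𝒟_{T₁} ⊕ (𝒟_{T₂} ⊕ E)`. -/
def AndoSpace.vec {T₁ T₂ : H →L[ℂ] H} (E : Type v) [NormedAddCommGroup E]
    (f : defectSpace T₁) (g : defectSpace T₂) : AndoSpace T₁ T₂ E :=
  WithLp.toLp 2 (f, WithLp.toLp 2 (g, 0))

/-- An Andô tuple `(F, Λ, P, U)` of a pair `(T₁, T₂)` of commuting contractions. The space is
`F = 𝒟_{T₁} ⊕ (𝒟_{T₂} ⊕ E)` with an auxiliary Hilbert space `E`, large enough for the unitary `U`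
to exist (the choices `E = 0` and `E = ℓ²` give `𝒟_{T₁} ⊕ 𝒟_{T₂}` and `𝒟_{T₁} ⊕ (𝒟_{T₂} ⊕ ℓ²)`).
The isometry `Λ` is determined by its values on the range of `D_{T₁T₂}`, which is dense in
`𝒟_{T₁T₂}`, and `U` is any unitary extension of the isometry
`D_{T₁}T₂h ⊕ D_{T₂}h ↦ D_{T₁}h ⊕ D_{T₂}T₁h`. -/
structure AndoTuple (T₁ T₂ : H →L[ℂ] H) where
  E : Type v
  [instNormedAddCommGroup : NormedAddCommGroup E]
  [instInnerProductSpace : InnerProductSpace ℂ E]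
  [instCompleteSpace : CompleteSpace E]
  Λ : defectSpace (T₁ * T₂) →ₗᵢ[ℂ] AndoSpace T₁ T₂ E
  U : AndoSpace T₁ T₂ E ≃ₗᵢ[ℂ] AndoSpace T₁ T₂ E
  Λ_defect : ∀ h : H, Λ (defectTo (T₁ * T₂) h) =
    AndoSpace.vec E (defectTo T₁ (T₂ h)) (defectTo T₂ h)
  U_vec : ∀ h : H, U (AndoSpace.vec E (defectTo T₁ (T₂ h)) (defectTo T₂ h)) =
    AndoSpace.vec E (defectTo T₁ h) (defectTo T₂ (T₁ h))

namespace AndoTuple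

attribute [instance] instNormedAddCommGroup instInnerProductSpace instCompleteSpace

variable {T₁ T₂ : H →L[ℂ] H} (A : AndoTuple.{u, v} T₁ T₂)

/-- The space `F` of the Andô tuple. -/
abbrev F : Type (max u v) := AndoSpace T₁ T₂ A.E

/-- The orthogonal projection `P` of `F` onto the summand `𝒟_{T₁}`. -/
def P : A.F →L[ℂ] A.F := blockOp 1 0 0 0

/-- The complementary projection `P^⊥ = I - P`. -/
def Pperp : A.F →L[ℂ] A.F := 1 - A.P

/-- `Λ` as a bounded operator. -/
def ΛL : defectSpace (T₁ * T₂) →L[ℂ] A.F := A.Λ.toContinuousLinearMap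

/-- `U` as a bounded operator. -/
def UL : A.F →L[ℂ] A.F := A.U.toLinearIsometry.toContinuousLinearMap

end AndoTuple

/-! ### The Schäffer-type Andô dilation -/

section Schaffer

variable {T₁ T₂ : H →L[ℂ] H} (A : AndoTuple.{u, v} T₁ T₂)

/-- `V₁^S = (T₁ 0; P U Λ D_T  M_φ)` on `H ⊕ H²(F)`, where `φ(z) = P^⊥ U + z P U`. -/
def schaffer₁ : WithLp 2 (H × H2 A.F) →L[ℂ] WithLp 2 (H × H2 A.F) :=
  blockOp T₁ 0
    (H2.const ∘L (A.P * A.UL) ∘L A.ΛL ∘L defectTo (T₁ * T₂))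
    (H2.mulOp (A.Pperp * A.UL) (A.P * A.UL))

/-- `V₂^S = (T₂ 0; U* P^⊥ Λ D_T  M_ψ)` on `H ⊕ H²(F)`, where `ψ(z) = U* P + z U* P^⊥`. -/
def schaffer₂ : WithLp 2 (H × H2 A.F) →L[ℂ] WithLp 2 (H × H2 A.F) :=
  blockOp T₂ 0
    (H2.const ∘L (A.UL† * A.Pperp) ∘L A.ΛL ∘L defectTo (T₁ * T₂))
    (H2.mulOp (A.UL† * A.P) (A.UL† * A.Pperp))

/-- `Π_Λ = I_H ⊕ (I_{H²} ⊗ Λ) : H ⊕ H²(𝒟_T) → H ⊕ H²(F)`. -/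
def piΛ : WithLp 2 (H × H2 (defectSpace (T₁ * T₂))) →L[ℂ] WithLp 2 (H × H2 A.F) :=
  blockOp 1 0 0 (H2.map A.ΛL)

end Schaffer

/-! ### The Douglas-type Andô dilation -/

/-- The residual part of the Douglas-type dilation of a pair `(T₁, T₂)` of commuting contractions
with product `T = T₁T₂`.
* `Q` is the positive square root of the strong limit of `Tⁿ T*ⁿ`.
* `R` is a Hilbert space containing (through the isometry `ι`) the closure of the range of `Q`.
* `W₁, W₂` are commuting unitaries on `R` such that `(W₁*, W₂*)` extends `(X₁*, X₂*)`, where `Xᵢ*` is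
  the bounded operator on the closure of `Ran Q` determined by `Xᵢ* Q = Q Tᵢ*`; the adjoint of a
  unitary is its inverse.
* `W* = (W₁W₂)*` is the minimal unitary extension of the isometry `X* = X₁*X₂*`: the spaces
  `Wⁿ (closure of Ran Q)`, `n ∈ ℤ`, together span a dense subspace of `R`. -/
structure DouglasResidual (T₁ T₂ : H →L[ℂ] H) where
  Q : H →L[ℂ] H
  Q_nonneg : 0 ≤ Q
  Q_tendsto : ∀ h : H,
    Tendsto (fun n : ℕ => ((T₁ * T₂) ^ n * ((T₁ * T₂)†) ^ n) h) atTop (𝓝 ((Q * Q) h))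
  R : Type w
  [instNormedAddCommGroup : NormedAddCommGroup R]
  [instInnerProductSpace : InnerProductSpace ℂ R]
  [instCompleteSpace : CompleteSpace R]
  ι : Q.range.topologicalClosure →ₗᵢ[ℂ] R
  W₁ : R ≃ₗᵢ[ℂ] R
  W₂ : R ≃ₗᵢ[ℂ] R
  W_comm : W₁ * W₂ = W₂ * W₁
  W₁_extends : ∀ h : H,
    W₁.symm (ι ⟨Q h, Submodule.le_topologicalClosure _ (LinearMap.mem_range_self _ h)⟩) =
      ι ⟨Q ((T₁†) h), Submodule.le_topologicalClosure _ (LinearMap.mem_range_self _ _)⟩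
  W₂_extends : ∀ h : H,
    W₂.symm (ι ⟨Q h, Submodule.le_topologicalClosure _ (LinearMap.mem_range_self _ h)⟩) =
      ι ⟨Q ((T₂†) h), Submodule.le_topologicalClosure _ (LinearMap.mem_range_self _ _)⟩
  minimal : (Submodule.span ℂ {y : R | ∃ (n : ℤ) (x : Q.range.topologicalClosure),
    y = ((W₁ * W₂) ^ n) (ι x)}).topologicalClosure = ⊤

namespace DouglasResidual

attribute [instance] instNormedAddCommGroup instInnerProductSpace instCompleteSpace

variable {T₁ T₂ : H →L[ℂ] H} (D : DouglasResidual.{u, w} T₁ T₂)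

/-- `W₁` as a bounded operator. -/
def W₁L : D.R →L[ℂ] D.R := D.W₁.toLinearIsometry.toContinuousLinearMap

/-- `W₂` as a bounded operator. -/
def W₂L : D.R →L[ℂ] D.R := D.W₂.toLinearIsometry.toContinuousLinearMap

end DouglasResidual

section Douglas

/- The Andô tuple `(F_*, Γ, P', U')` is one of `(T₁*, T₂*)`. As `T₁` and `T₂` commute,
`T₁* T₂* = T*`, and the domain of `Γ` is `𝒟_{T*}`. -/
variable {T₁ T₂ : H →L[ℂ] H} (B : AndoTuple.{u, v} (T₁†) (T₂†)) (D : DouglasResidual.{u, w} T₁ T₂)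

/-- `V₁^D = M_φ ⊕ W₁` on `H²(F_*) ⊕ R`, where `φ(z) = U'* P'^⊥ + z U'* P'`. -/
def douglas₁ : WithLp 2 (H2 B.F × D.R) →L[ℂ] WithLp 2 (H2 B.F × D.R) :=
  blockOp (H2.mulOp (B.UL† * B.Pperp) (B.UL† * B.P)) 0 0 D.W₁L

/-- `V₂^D = M_ψ ⊕ W₂` on `H²(F_*) ⊕ R`, where `ψ(z) = P' U' + z P'^⊥ U'`. -/
def douglas₂ : WithLp 2 (H2 B.F × D.R) →L[ℂ] WithLp 2 (H2 B.F × D.R) :=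
  blockOp (H2.mulOp (B.P * B.UL) (B.Pperp * B.UL)) 0 0 D.W₂L

/-- `Π_Γ = (I_{H²} ⊗ Γ) ⊕ I_R : H²(𝒟_{T*}) ⊕ R → H²(F_*) ⊕ R`. -/
def piΓ : WithLp 2 (H2 (defectSpace (T₁† * T₂†)) × D.R) →L[ℂ] WithLp 2 (H2 B.F × D.R) :=
  blockOp (H2.map B.ΛL) 0 0 1

end Douglas

end

end Ando

namespace Ando

open scoped InnerProduct

noncomputable section

/-! ### Families with a prescribed Gram matrix -/

section Gram

variable {ι K L : Type*} [NormedAddCommGroup K] [InnerProductSpace ℂ K] [NormedAddCommGroup L]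
  [InnerProductSpace ℂ L]

/-! The two compressed triples are never compared directly; both are instances of an object that the
pair `(T₁, T₂)` determines up to one unitary. That object (`IsPseudoLift`) is a minimal isometric
lift `V` of `T = T₁T₂` along an embedding `J` of `H`, together with `S₁, S₂` that commute with `V`,
satisfy `Sᵢ* J = J Tᵢ*`, and are tied to each other by `S₁ = S₂* V` and `S₂ = S₁* V`.

Uniqueness (`IsPseudoLift.unitarilyEquivalent`) is a Gram matrix argument. The inner products of the
total family `Vⁿ J h` depend on `T` only, which gives the unitary. The inner products of `S₁ J h`
with this family depend on `T₁`, `T₂` only, because `S₁* V = S₂` removes one factor `V` and `S₂* J =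
J T₂*` then applies; commutation with `V` determines `S₁` on the rest.

The source of such triples is `IsPseudoLift.compression`: commuting isometries are compressed to a
subspace that reduces their product. The subspace need not be invariant under either factor, so the
surplus space `E` and the choice of `U` leave no trace. On the Schäffer side the product compresses
to the Schäffer dilation of `T`; on the Douglas side it compresses to `M_z ⊕ W`, with the embedding
`h ↦ (D_{T*} T*ⁿ h)ₙ ⊕ Qh`. Both are minimal.

Existence of Andô tuples: `‖D_{T₁}T₂h‖² + ‖D_{T₂}h‖²` and `‖D_{T₁}h‖² + ‖D_{T₂}T₁h‖²` both telescope
to `‖D_T h‖²`, and a Halmos dilation extends the resulting partial isometry to a unitary. Existence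
of the residual part: `Q Tᵢ*` and `Q` have equal norms on each vector, so the maps `Xᵢ*` are
isometries; they extend along the minimal unitary extension of their product, where they become
invertible because their product is. -/

theorem norm_linearCombination_eq_of_gram {x : ι → K} {y : ι → L}
    (h : ∀ i j, inner ℂ (y i) (y j) = inner ℂ (x i) (x j)) (c : ι →₀ ℂ) :
    ‖Finsupp.linearCombination ℂ y c‖ = ‖Finsupp.linearCombination ℂ x c‖ := by
  have : inner ℂ (Finsupp.linearCombination ℂ y c) (Finsupp.linearCombination ℂ y c) =
      inner ℂ (Finsupp.linearCombination ℂ x c) (Finsupp.linearCombination ℂ x c) := by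
    simp only [Finsupp.linearCombination_apply, Finsupp.sum, sum_inner, inner_sum,
      inner_smul_left, inner_smul_right, h]
  rw [@norm_eq_sqrt_re_inner ℂ, @norm_eq_sqrt_re_inner ℂ, this]

theorem denseRange_linearCombination {x : ι → K}
    (hx : (Submodule.span ℂ (Set.range x)).topologicalClosure = ⊤) :
    DenseRange (Finsupp.linearCombination ℂ x) := by
  rw [DenseRange, ← LinearMap.coe_range, Finsupp.range_linearCombination]
  exact Submodule.dense_iff_topologicalClosure_eq_top.2 hx

/-- A map that preserves the Gram matrix of a total family extends to a linear isometry. -/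
theorem exists_linearIsometry_of_gram [CompleteSpace L] {x : ι → K} {y : ι → L}
    (hx : (Submodule.span ℂ (Set.range x)).topologicalClosure = ⊤)
    (h : ∀ i j, inner ℂ (y i) (y j) = inner ℂ (x i) (x j)) :
    ∃ V : K →ₗᵢ[ℂ] L, ∀ i, V (x i) = y i := by
  have hd := denseRange_linearCombination hx
  have hn := norm_linearCombination_eq_of_gram h
  have hb : ∃ C, ∀ c, ‖Finsupp.linearCombination ℂ y c‖ ≤
      C * ‖Finsupp.linearCombination ℂ x c‖ := ⟨1, fun c => by rw [hn, one_mul]⟩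
  let V := (Finsupp.linearCombination ℂ y).extendOfNorm (Finsupp.linearCombination ℂ x)
  have hV : ∀ x, ‖V x‖ = ‖x‖ := by
    refine hd.induction ?_ (isClosed_eq (by fun_prop) (by fun_prop))
    rintro _ ⟨c, rfl⟩
    exact (congrArg norm (LinearMap.extendOfNorm_eq hd hb c)).trans (hn c)
  refine ⟨⟨V.toLinearMap, hV⟩, fun i => ?_⟩
  simpa using! LinearMap.extendOfNorm_eq hd hb (Finsupp.single i 1)

/-- Two total families with the same Gram matrix are unitarily equivalent. -/
theorem exists_linearIsometryEquiv_of_gram [CompleteSpace K] [CompleteSpace L] {x : ι → K}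
    {y : ι → L} (hx : (Submodule.span ℂ (Set.range x)).topologicalClosure = ⊤)
    (hy : (Submodule.span ℂ (Set.range y)).topologicalClosure = ⊤)
    (h : ∀ i j, inner ℂ (y i) (y j) = inner ℂ (x i) (x j)) :
    ∃ V : K ≃ₗᵢ[ℂ] L, ∀ i, V (x i) = y i := by
  refine ⟨(LinearEquiv.refl ℂ (ι →₀ ℂ)).extendOfIsometry (Finsupp.linearCombination ℂ x)
    (Finsupp.linearCombination ℂ y) (denseRange_linearCombination hx)
    (denseRange_linearCombination hy) (norm_linearCombination_eq_of_gram h), fun i => ?_⟩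
  simpa using (LinearEquiv.refl ℂ (ι →₀ ℂ)).extendOfIsometry_eq _ _
    (denseRange_linearCombination hx) (denseRange_linearCombination hy)
    (norm_linearCombination_eq_of_gram h) (Finsupp.single i 1)

theorem eqOn_of_total {x : ι → K}
    (hx : (Submodule.span ℂ (Set.range x)).topologicalClosure = ⊤) {f g : K →L[ℂ] L}
    (h : ∀ i, f (x i) = g (x i)) : f = g :=
  ContinuousLinearMap.ext_on (Submodule.dense_iff_topologicalClosure_eq_top.2 hx)
    (by rintro _ ⟨i, rfl⟩; exact h i)

/-- Identifies a vector by its inner products with a total family; this is how `S₁ J h` is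
recognised in the uniqueness proof. -/
theorem eq_of_inner_total {x : ι → K}
    (hx : (Submodule.span ℂ (Set.range x)).topologicalClosure = ⊤) {a b : K}
    (h : ∀ i, inner ℂ (x i) a = inner ℂ (x i) b) : a = b := by
  have : innerSL ℂ a = innerSL ℂ b := eqOn_of_total hx fun i => by
    rw [innerSL_apply_apply, innerSL_apply_apply, ← inner_conj_symm, h, inner_conj_symm]
  exact ext_inner_right ℂ fun y => by simpa using congrArg (fun f => f y) this

end Gram

/-! ### Pseudo-commuting lifts: uniqueness, and construction by compression -/

section Lift

variable {H K L : Type*} [NormedAddCommGroup H] [InnerProductSpace ℂ H] [CompleteSpace H]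
  [NormedAddCommGroup K] [InnerProductSpace ℂ K] [CompleteSpace K]
  [NormedAddCommGroup L] [InnerProductSpace ℂ L] [CompleteSpace L]

theorem inner_map_map_of_adjoint_comp {V : K →L[ℂ] L} (hV : V† ∘L V = 1) (x y : K) :
    inner ℂ (V x) (V y) = inner ℂ x y := by
  rw [← ContinuousLinearMap.adjoint_inner_right, ← ContinuousLinearMap.comp_apply, hV,
    one_apply_eq_self]

theorem inner_pow_map_map_of_adjoint_comp {V : K →L[ℂ] K} (hV : V† ∘L V = 1) (n : ℕ) (x y : K) :
    inner ℂ ((V ^ n) x) ((V ^ n) y) = inner ℂ x y := by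
  induction n with
  | zero => simp
  | succ n ih => simp only [pow_succ', mul_apply_eq_comp,
      inner_map_map_of_adjoint_comp hV, ih]

/-- `(S₁, S₂, V)` is a lift of `(T₁, T₂, T₁T₂)` along `J : H → K`, where `V` is a minimal isometric
lift of `T₁T₂` and `(S₁, S₂)` commute with `V` and satisfy `S₁ = S₂* V`, `S₂ = S₁* V`. -/
structure IsPseudoLift (T₁ T₂ : H →L[ℂ] H) (J : H →ₗᵢ[ℂ] K) (S₁ S₂ V : K →L[ℂ] K) : Prop where
  lift₁ : ∀ h, (S₁†) (J h) = J ((T₁†) h)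
  lift₂ : ∀ h, (S₂†) (J h) = J ((T₂†) h)
  lift : ∀ h, (V†) (J h) = J (((T₁ * T₂)†) h)
  isometry : V† ∘L V = 1
  factor₁ : ∀ x, (S₂†) (V x) = S₁ x
  factor₂ : ∀ x, (S₁†) (V x) = S₂ x
  comm₁ : ∀ x, S₁ (V x) = V (S₁ x)
  comm₂ : ∀ x, S₂ (V x) = V (S₂ x)
  total : (Submodule.span ℂ (Set.range fun p : ℕ × H => (V ^ p.1) (J p.2))).topologicalClosure = ⊤

namespace IsPseudoLift

variable {T₁ T₂ : H →L[ℂ] H} {J : H →ₗᵢ[ℂ] K} {S₁ S₂ V : K →L[ℂ] K}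
  {J' : H →ₗᵢ[ℂ] L} {S₁' S₂' V' : L →L[ℂ] L}

theorem swap (h : IsPseudoLift T₁ T₂ J S₁ S₂ V) (hc : T₁ * T₂ = T₂ * T₁) :
    IsPseudoLift T₂ T₁ J S₂ S₁ V :=
  ⟨h.lift₂, h.lift₁, hc ▸ h.lift, h.isometry, h.factor₂, h.factor₁, h.comm₂, h.comm₁, h.total⟩

/-- Each factor `V` moves to the left and is absorbed by `V* J = J T*`, so the right-hand side no
longer mentions the lift. -/
theorem inner_pow (hS : IsPseudoLift T₁ T₂ J S₁ S₂ V) (n : ℕ) (h k : H) :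
    inner ℂ (J h) ((V ^ n) (J k)) = inner ℂ (((T₁ * T₂)† ^ n) h) k := by
  induction n generalizing h with
  | zero => simp
  | succ n ih =>
    rw [pow_succ', mul_apply_eq_comp, ← ContinuousLinearMap.adjoint_inner_left,
      hS.lift, ih, pow_succ, mul_apply_eq_comp]

/-- The common power of the isometry cancels, and what is left is a one-sided power computed by
`inner_pow` from `T` alone. -/
theorem inner_pow_pow (hS : IsPseudoLift T₁ T₂ J S₁ S₂ V) (hS' : IsPseudoLift T₁ T₂ J' S₁' S₂' V')
    (p q : ℕ × H) : inner ℂ ((V' ^ p.1) (J' p.2)) ((V' ^ q.1) (J' q.2)) =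
      inner ℂ ((V ^ p.1) (J p.2)) ((V ^ q.1) (J q.2)) := by
  obtain ⟨m, h⟩ := p
  obtain ⟨n, k⟩ := q
  dsimp only
  rcases le_total m n with hmn | hmn
  · obtain ⟨j, rfl⟩ := Nat.exists_eq_add_of_le hmn
    simp only [pow_add, mul_apply_eq_comp,
      inner_pow_map_map_of_adjoint_comp hS.isometry, inner_pow_map_map_of_adjoint_comp hS'.isometry,
      hS.inner_pow, hS'.inner_pow]
  · obtain ⟨j, rfl⟩ := Nat.exists_eq_add_of_le hmn
    rw [← inner_conj_symm, ← inner_conj_symm ((V ^ _) _)]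
    simp only [pow_add, mul_apply_eq_comp,
      inner_pow_map_map_of_adjoint_comp hS.isometry, inner_pow_map_map_of_adjoint_comp hS'.isometry,
      hS.inner_pow, hS'.inner_pow]

theorem comm_pow (hS : IsPseudoLift T₁ T₂ J S₁ S₂ V) (n : ℕ) (x : K) :
    S₁ ((V ^ n) x) = (V ^ n) (S₁ x) := by
  induction n with
  | zero => simp
  | succ n ih => simp only [pow_succ', mul_apply_eq_comp, hS.comm₁, ih]

/-- The heart of uniqueness: the lifting relations and the factorisation `S₁* V = S₂` already fix
the position of `S₁ J h` relative to the total family. -/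
theorem inner_total_apply (hS : IsPseudoLift T₁ T₂ J S₁ S₂ V)
    (hS' : IsPseudoLift T₁ T₂ J' S₁' S₂' V') (p : ℕ × H) (h : H) :
    inner ℂ ((V' ^ p.1) (J' p.2)) (S₁' (J' h)) = inner ℂ ((V ^ p.1) (J p.2)) (S₁ (J h)) := by
  obtain ⟨n, k⟩ := p
  dsimp only
  cases n with
  | zero =>
    simp only [pow_zero, one_apply_eq_self]
    rw [← ContinuousLinearMap.adjoint_inner_left, ← ContinuousLinearMap.adjoint_inner_left,
      hS.lift₁, hS'.lift₁, J.inner_map_map, J'.inner_map_map]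
  | succ n =>
    -- Here `⟨V Vⁿ J k, S₁ J h⟩ = ⟨S₂ Vⁿ J k, J h⟩ = ⟨Vⁿ J k, J T₂* h⟩`, which is an entry of the
    -- Gram matrix.
    rw [pow_succ', pow_succ', mul_apply_eq_comp, mul_apply_eq_comp,
      ← ContinuousLinearMap.adjoint_inner_left, ← ContinuousLinearMap.adjoint_inner_left,
      hS.factor₂, hS'.factor₂, ← ContinuousLinearMap.adjoint_inner_right S₂,
      ← ContinuousLinearMap.adjoint_inner_right S₂', hS.lift₂, hS'.lift₂]
    simpa using inner_pow_pow hS hS' (n, k) (0, (T₂†) h)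

/-- On the orbit vectors `S₁ Vⁿ J h = Vⁿ S₁ J h`, so intertwining on `J h` and intertwining of `V`
suffice. The claim for `S₂` follows by exchanging the roles of `T₁` and `T₂`. -/
theorem intertwines (hS : IsPseudoLift T₁ T₂ J S₁ S₂ V)
    (hS' : IsPseudoLift T₁ T₂ J' S₁' S₂' V') (τ : K ≃ₗᵢ[ℂ] L)
    (hτ : ∀ p : ℕ × H, τ ((V ^ p.1) (J p.2)) = (V' ^ p.1) (J' p.2)) :
    (∀ x, τ (V x) = V' (τ x)) ∧ ∀ x, τ (S₁ x) = S₁' (τ x) := by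
  let τL : K →L[ℂ] L := τ.toLinearIsometry.toContinuousLinearMap
  have hV : τL ∘L V = V' ∘L τL := eqOn_of_total hS.total fun p => by
    refine Eq.trans ?_ ((hτ (p.1 + 1, p.2)).trans ?_)
    · simp [τL, pow_succ']
    · change (V' ^ (p.1 + 1)) (J' p.2) = V' (τ ((V ^ p.1) (J p.2)))
      rw [hτ, pow_succ', mul_apply_eq_comp]
  have hV' : ∀ x, τ (V x) = V' (τ x) := fun x => congrArg (fun f => f x) hV
  have hVn : ∀ (n : ℕ) x, τ ((V ^ n) x) = (V' ^ n) (τ x) := fun n x => by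
    induction n with
    | zero => simp
    | succ n ih => simp only [pow_succ', mul_apply_eq_comp, hV', ih]
  have hJ : ∀ h, τ (S₁ (J h)) = S₁' (J' h) := fun h =>
    eq_of_inner_total hS'.total fun p => by
      rw [inner_total_apply hS hS', ← hτ, τ.inner_map_map]
  refine ⟨hV', fun x => ?_⟩
  have : τL ∘L S₁ = S₁' ∘L τL := eqOn_of_total hS.total fun p => by
    change τ (S₁ ((V ^ p.1) (J p.2))) = S₁' (τ ((V ^ p.1) (J p.2)))
    rw [hτ, hS.comm_pow, hS'.comm_pow, hVn, hJ]
  exact congrArg (fun f => f x) this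

/-- A pseudo-commuting lift with minimal isometric product is unique up to unitary equivalence. -/
theorem unitarilyEquivalent (hc : T₁ * T₂ = T₂ * T₁) (hS : IsPseudoLift T₁ T₂ J S₁ S₂ V)
    (hS' : IsPseudoLift T₁ T₂ J' S₁' S₂' V') :
    UnitarilyEquivalent ![S₁, S₂, V] ![S₁', S₂', V'] := by
  obtain ⟨τ, hτ⟩ := exists_linearIsometryEquiv_of_gram hS.total hS'.total (inner_pow_pow hS hS')
  obtain ⟨hV, h₁⟩ := intertwines hS hS' τ hτ
  obtain ⟨-, h₂⟩ := intertwines (hS.swap hc) (hS'.swap hc) τ hτ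
  refine ⟨τ, fun i x => ?_⟩
  fin_cases i
  exacts [h₁ x, h₂ x, hV x]

theorem unitarilyEquivalent_of_eq (hc : T₁ * T₂ = T₂ * T₁) {A : Fin 3 → K →L[ℂ] K}
    {B : Fin 3 → L →L[ℂ] L} (hA : A = ![S₁, S₂, V]) (hB : B = ![S₁', S₂', V'])
    (hS : IsPseudoLift T₁ T₂ J S₁ S₂ V) (hS' : IsPseudoLift T₁ T₂ J' S₁' S₂' V') :
    UnitarilyEquivalent A B :=
  hA ▸ hB ▸ unitarilyEquivalent hc hS hS'

/-- The compression of a pair of commuting isometries to a reducing subspace of their product. -/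
theorem compression {V₁ V₂ : L →L[ℂ] L} {Φ : K →L[ℂ] L}
    (hV₁ : V₁† ∘L V₁ = 1) (hV₂ : V₂† ∘L V₂ = 1) (hcomm : V₁ * V₂ = V₂ * V₁) (hΦ : Φ† ∘L Φ = 1)
    (hV : (V₁ * V₂) ∘L Φ = Φ ∘L V) (hV' : Φ† ∘L (V₁ * V₂) = V ∘L Φ†)
    (h₁ : ∀ h, (V₁†) (Φ (J h)) = Φ (J ((T₁†) h))) (h₂ : ∀ h, (V₂†) (Φ (J h)) = Φ (J ((T₂†) h)))
    (hcT : T₁ * T₂ = T₂ * T₁)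
    (ht : (Submodule.span ℂ
      (Set.range fun p : ℕ × H => (V ^ p.1) (J p.2))).topologicalClosure = ⊤) :
    IsPseudoLift T₁ T₂ J (Φ† ∘L V₁ ∘L Φ) (Φ† ∘L V₂ ∘L Φ) V := by
  have eΦ : ∀ x, (Φ†) (Φ x) = x := fun x => congrArg (fun f => f x) hΦ
  have e₁ : ∀ x, (V₁†) (V₁ x) = x := fun x => congrArg (fun f => f x) hV₁
  have e₂ : ∀ x, (V₂†) (V₂ x) = x := fun x => congrArg (fun f => f x) hV₂
  have ec : ∀ x, V₁ (V₂ x) = V₂ (V₁ x) := fun x => congrArg (fun f => f x) hcomm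
  have eV : ∀ x, V₁ (V₂ (Φ x)) = Φ (V x) := fun x => congrArg (fun f => f x) hV
  have eV' : ∀ x, (Φ†) (V₁ (V₂ x)) = V ((Φ†) x) := fun x => congrArg (fun f => f x) hV'
  have hVc : V = Φ† ∘L (V₁ * V₂) ∘L Φ := by
    ext x; simp [eV, eΦ]
  have key : ∀ {x y : K}, inner ℂ (Φ x) (Φ y) = inner ℂ x y :=
    fun {x y} => inner_map_map_of_adjoint_comp hΦ x y
  refine ⟨fun h => ?_, fun h => ?_, fun h => ?_, ?_, fun x => ?_, fun x => ?_, fun x => ?_,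
    fun x => ?_, ht⟩
  · simp [ContinuousLinearMap.adjoint_comp, h₁, eΦ]
  · simp [ContinuousLinearMap.adjoint_comp, h₂, eΦ]
  · rw [hVc, hcomm, hcT]
    simp [ContinuousLinearMap.adjoint_comp, ContinuousLinearMap.mul_def, h₁, h₂, eΦ]
  · ext x
    refine ext_inner_left ℂ fun y => ?_
    simp only [ContinuousLinearMap.comp_apply, one_apply_eq_self]
    rw [ContinuousLinearMap.adjoint_inner_right, ← key, ← eV, ← eV,
      inner_map_map_of_adjoint_comp hV₁, inner_map_map_of_adjoint_comp hV₂, key]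
  -- `S₂* V = Φ* V₂* V₁V₂ Φ = Φ* V₂* V₂V₁ Φ = Φ* V₁ Φ`. The projection `ΦΦ*` inside `S₂* V`
  -- disappears because `ΦV = V₁V₂Φ`.
  · simp [ContinuousLinearMap.adjoint_comp, ← eV, ec, e₂]
  · simp [ContinuousLinearMap.adjoint_comp, ← eV, e₁]
  -- Both sides equal `Φ* V₁ (V₁V₂) Φ`; the right-hand side needs `hV'`, that is, that the range of
  -- `Φ` reduces `V₁V₂`.
  · simp only [ContinuousLinearMap.comp_apply, ← eV, ← eV', ec]
  · simp only [ContinuousLinearMap.comp_apply, ← eV, ← eV', ec]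

end IsPseudoLift

end Lift

/-! ### Block operators: products and adjoints -/

section Block

variable {K₁ K₂ L₁ L₂ M₁ M₂ : Type*}
    [NormedAddCommGroup K₁] [InnerProductSpace ℂ K₁] [NormedAddCommGroup K₂]
    [InnerProductSpace ℂ K₂] [NormedAddCommGroup L₁] [InnerProductSpace ℂ L₁]
    [NormedAddCommGroup L₂] [InnerProductSpace ℂ L₂] [NormedAddCommGroup M₁]
    [InnerProductSpace ℂ M₁] [NormedAddCommGroup M₂] [InnerProductSpace ℂ M₂]

theorem prod_ext {f g : WithLp 2 (K₁ × K₂) →L[ℂ] M₁}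
    (h : ∀ x y, f (WithLp.toLp 2 (x, y)) = g (WithLp.toLp 2 (x, y))) : f = g :=
  ContinuousLinearMap.ext fun x => h x.fst x.snd

theorem blockOp_comp (A' : L₁ →L[ℂ] M₁) (B' : L₂ →L[ℂ] M₁) (C' : L₁ →L[ℂ] M₂) (D' : L₂ →L[ℂ] M₂)
    (A : K₁ →L[ℂ] L₁) (B : K₂ →L[ℂ] L₁) (C : K₁ →L[ℂ] L₂) (D : K₂ →L[ℂ] L₂) :
    blockOp A' B' C' D' ∘L blockOp A B C D =
      blockOp (A' ∘L A + B' ∘L C) (A' ∘L B + B' ∘L D) (C' ∘L A + D' ∘L C)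
        (C' ∘L B + D' ∘L D) := by
  refine prod_ext fun x y => ?_
  simp only [ContinuousLinearMap.comp_apply, blockOp_toLp, map_add, add_apply]
  congr 2 <;> abel

theorem blockOp_one : blockOp (1 : K₁ →L[ℂ] K₁) 0 0 (1 : K₂ →L[ℂ] K₂) = 1 :=
  prod_ext fun x y => by simp [blockOp_toLp]

variable [CompleteSpace K₁] [CompleteSpace K₂] [CompleteSpace L₁] [CompleteSpace L₂]

theorem adjoint_blockOp (A : K₁ →L[ℂ] L₁) (B : K₂ →L[ℂ] L₁) (C : K₁ →L[ℂ] L₂) (D : K₂ →L[ℂ] L₂) :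
    (blockOp A B C D)† = blockOp (A†) (C†) (B†) (D†) := by
  refine ((ContinuousLinearMap.eq_adjoint_iff _ _).2 fun x y => ?_).symm
  obtain ⟨x₁, x₂⟩ := x
  obtain ⟨y₁, y₂⟩ := y
  change inner ℂ (blockOp (A†) (C†) (B†) (D†) (WithLp.toLp 2 (x₁, x₂))) (WithLp.toLp 2 (y₁, y₂)) =
    inner ℂ (WithLp.toLp 2 (x₁, x₂)) (blockOp A B C D (WithLp.toLp 2 (y₁, y₂)))
  simp only [blockOp_toLp, WithLp.prod_inner_apply, inner_add_left, inner_add_right,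
    ContinuousLinearMap.adjoint_inner_left]
  ring

end Block

/-! ### Multiplication by affine symbols on the vector-valued Hardy space -/

namespace H2

variable {F G E : Type*} [NormedAddCommGroup F] [InnerProductSpace ℂ F]
  [NormedAddCommGroup G] [InnerProductSpace ℂ G] [NormedAddCommGroup E] [InnerProductSpace ℂ E]

theorem map_comp (A : G →L[ℂ] E) (B : F →L[ℂ] G) : map A ∘L map B = map (A ∘L B) := rfl

theorem map_one : map (1 : F →L[ℂ] F) = 1 := rfl

@[simp] theorem const_zero (v : F) : (const v : H2 F) 0 = v := by
  simp [const]

@[simp] theorem const_succ (v : F) (n : ℕ) : (const v : H2 F) (n + 1) = 0 := by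
  simp [const]

@[simp] theorem mulOp_zero (A B : F →L[ℂ] F) (f : H2 F) : mulOp A B f 0 = A (f 0) :=
  add_zero (A (f 0))

@[simp] theorem mulOp_succ (A B : F →L[ℂ] F) (f : H2 F) (n : ℕ) :
    mulOp A B f (n + 1) = A (f (n + 1)) + B (f n) := rfl

theorem map_const (A : F →L[ℂ] G) (v : F) : map A (const v) = const (A v) := by
  ext n; cases n <;> simp

theorem map_shift (A : F →L[ℂ] G) (f : H2 F) : map A (shift f) = shift (map A f) := by
  ext n; cases n <;> simp

/-- The hypotheses say that the symbols satisfy `(A + zB)(C + zD) = z`, coefficient by coefficient.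
-/
theorem mulOp_mulOp {A B C D : F →L[ℂ] F} (hAC : A * C = 0) (hBD : B * D = 0)
    (h : A * D + B * C = 1) (f : H2 F) : mulOp A B (mulOp C D f) = shift f := by
  have h₁ : ∀ x, A (C x) = 0 := fun x => congrArg (fun f => f x) hAC
  have h₂ : ∀ x, B (D x) = 0 := fun x => congrArg (fun f => f x) hBD
  have h₃ : ∀ x, A (D x) + B (C x) = x := fun x => congrArg (fun f => f x) h
  ext n
  rcases n with _ | _ | n <;> simp [h₁, h₂, h₃]

theorem mulOp_const (A B : F →L[ℂ] F) {v : F} (hv : B v = 0) :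
    mulOp A B (const v) = const (A v) := by
  ext n
  rcases n with _ | _ | n <;> simp [hv]

theorem inner_const_left (v : F) (f : H2 F) : inner ℂ (const v) f = inner ℂ v (f 0) :=
  lp.inner_single_left 0 v f

theorem norm_const (v : F) : ‖(const v : H2 F)‖ = ‖v‖ := by
  simp [const]

theorem norm_shift (f : H2 F) : ‖shift f‖ = ‖f‖ := by
  refine (pow_left_inj₀ (norm_nonneg _) (norm_nonneg _) two_ne_zero).1 ?_
  rw [norm_sq, norm_sq]
  exact ((summable_shift f).tsum_eq_zero_add).trans (by simp [shiftFun])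

/-- Since `A` and `B` have orthogonal ranges, the two summands of the product are orthogonal in
every coefficient, and Pythagoras applies. -/
theorem norm_mulOp {A B : F →L[ℂ] F} (h₀ : ∀ x y, inner ℂ (A x) (B y) = 0)
    (h : ∀ x, ‖A x‖ ^ 2 + ‖B x‖ ^ 2 = ‖x‖ ^ 2) (f : H2 F) : ‖mulOp A B f‖ = ‖f‖ := by
  refine (pow_left_inj₀ (norm_nonneg _) (norm_nonneg _) two_ne_zero).1 ?_
  have hin : inner ℂ (map A f) (shift (map B f)) = 0 := by
    rw [lp.inner_eq_tsum]
    refine (tsum_congr fun n => ?_).trans tsum_zero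
    cases n <;> simp [h₀]
  have := norm_add_sq (𝕜 := ℂ) (map A f) (shift (map B f))
  rw [hin, norm_shift, map_zero, mul_zero, add_zero, norm_sq (map A f), norm_sq (map B f)] at this
  refine this.trans (((summable_map A f).tsum_add (summable_map B f)).symm.trans ?_)
  rw [norm_sq]
  exact tsum_congr fun n => h (f n)

theorem adjoint_map [CompleteSpace F] [CompleteSpace G] (A : F →L[ℂ] G) : (map A)† = map (A†) := by
  refine ((ContinuousLinearMap.eq_adjoint_iff _ _).2 fun x y => ?_).symm
  rw [lp.inner_eq_tsum, lp.inner_eq_tsum]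
  exact tsum_congr fun n => A.adjoint_inner_left (y n) (x n)

theorem shift_single (n : ℕ) (v : F) :
    shift (lp.single 2 n v : H2 F) = lp.single 2 (n + 1) v := by
  ext m
  cases m <;> simp [Pi.single_apply]

theorem adjoint_shift_apply [CompleteSpace F] (f : H2 F) (n : ℕ) : ((shift†) f) n = f (n + 1) := by
  refine ext_inner_left ℂ fun v : F => ?_
  refine (lp.inner_single_left (G := fun _ : ℕ => F) n v _).symm.trans
    (Eq.trans ?_ (lp.inner_single_left (G := fun _ : ℕ => F) (n + 1) v f))
  rw [ContinuousLinearMap.adjoint_inner_right, shift_single]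

theorem adjoint_mulOp_apply [CompleteSpace F] (A B : F →L[ℂ] F) (f : H2 F) (n : ℕ) :
    (((mulOp A B)†) f) n = (A†) (f n) + (B†) (f (n + 1)) := by
  rw [mulOp, map_add, ContinuousLinearMap.adjoint_comp, adjoint_map, adjoint_map,
    ← adjoint_shift_apply]
  rfl

theorem adjoint_shift_comp_shift [CompleteSpace F] :
    (shift (F := F))† ∘L shift = 1 :=
  (ContinuousLinearMap.norm_map_iff_adjoint_comp_self _).1 norm_shift

/-- A closed shift-invariant subspace of `H²(F)` that contains the constants is everything. -/
theorem eq_top_of_const_mem {N : Submodule ℂ (H2 F)} (hN : IsClosed (N : Set (H2 F)))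
    (hs : ∀ f ∈ N, shift f ∈ N) (hc : ∀ v, const v ∈ N) : N = ⊤ := by
  refine Submodule.eq_top_iff'.2 fun f => ?_
  have hsingle : ∀ (n : ℕ) (v : F), lp.single 2 n v ∈ N := fun n v => by
    induction n with
    | zero => exact hc v
    | succ n ih =>
      exact shift_single n v ▸ hs _ ih
  exact hN.mem_of_tendsto (lp.hasSum_single (by norm_num) f)
    (Eventually.of_forall fun s => N.sum_mem fun n _ => hsingle n _)

end H2

section

variable {H : Type u} [NormedAddCommGroup H] [InnerProductSpace ℂ H] [CompleteSpace H]

/-! ### Defect operators -/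

section Defect

theorem one_sub_adjoint_mul_nonneg {T : H →L[ℂ] H} (hT : ‖T‖ ≤ 1) : 0 ≤ 1 - T† * T := by
  rw [sub_nonneg, ← ContinuousLinearMap.star_eq_adjoint, ← CStarAlgebra.norm_le_one_iff_of_nonneg _
    (star_mul_self_nonneg T), CStarRing.norm_star_mul_self]
  exact mul_le_one₀ hT (norm_nonneg _) hT

theorem inner_defectTo {T : H →L[ℂ] H} (hT : ‖T‖ ≤ 1) (h k : H) :
    inner ℂ (defectTo T h) (defectTo T k) = inner ℂ h k - inner ℂ (T h) (T k) := by
  have hsa : IsSelfAdjoint (defect T) := (CFC.sqrt_nonneg _).isSelfAdjoint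
  change inner ℂ (defect T h) (defect T k) = _
  rw [← ContinuousLinearMap.adjoint_inner_right, ← ContinuousLinearMap.star_eq_adjoint,
    hsa.star_eq, ← mul_apply_eq_comp, defect,
    CFC.sqrt_mul_sqrt_self _ (one_sub_adjoint_mul_nonneg hT)]
  simp [inner_sub_right, ContinuousLinearMap.adjoint_inner_right]

theorem norm_defectTo_sq {T : H →L[ℂ] H} (hT : ‖T‖ ≤ 1) (h : H) :
    ‖defectTo T h‖ ^ 2 = ‖h‖ ^ 2 - ‖T h‖ ^ 2 := by
  have := congrArg Complex.re (inner_defectTo hT h h)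
  simpa only [Complex.sub_re, inner_self_eq_norm_sq_to_K, ← Complex.ofReal_pow,
    Complex.coe_algebraMap, Complex.ofReal_re] using this

theorem denseRange_defectTo (T : H →L[ℂ] H) : DenseRange (defectTo T) := by
  rintro ⟨x, hx⟩
  rw [closure_subtype]
  refine closure_mono ?_ hx
  rintro _ ⟨h, rfl⟩
  exact ⟨defectTo T h, ⟨h, rfl⟩, rfl⟩

/-- A closed subspace that contains the image of `D_T` contains the image of `𝒟_T`. -/
theorem forall_defectSpace_mem {T : H →L[ℂ] H} {K : Type*} [NormedAddCommGroup K]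
    [InnerProductSpace ℂ K] {N : Submodule ℂ K} (hN : IsClosed (N : Set K))
    (f : defectSpace T →L[ℂ] K) (h : ∀ x, f (defectTo T x) ∈ N) (d : defectSpace T) : f d ∈ N :=
  (denseRange_defectTo T).induction (by rintro _ ⟨x, rfl⟩; exact h x)
    (hN.preimage f.continuous) d

end Defect

theorem norm_mul_le_one {S T : H →L[ℂ] H} (hS : ‖S‖ ≤ 1) (hT : ‖T‖ ≤ 1) : ‖S * T‖ ≤ 1 :=
  (norm_mul_le S T).trans (mul_le_one₀ hS (norm_nonneg _) hT)

/-! ### Algebra of an Andô tuple -/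

namespace AndoTuple

variable {T₁ T₂ : H →L[ℂ] H} (A : AndoTuple.{u, v} T₁ T₂)

theorem P_toLp (x : defectSpace T₁) (y : WithLp 2 (defectSpace T₂ × A.E)) :
    A.P (WithLp.toLp 2 (x, y)) = WithLp.toLp 2 (x, 0) := by
  simp [P, blockOp_toLp]

theorem Pperp_toLp (x : defectSpace T₁) (y : WithLp 2 (defectSpace T₂ × A.E)) :
    A.Pperp (WithLp.toLp 2 (x, y)) = WithLp.toLp 2 (0, y) := by
  rw [Pperp, sub_apply, P_toLp, one_apply_eq_self, ← WithLp.toLp_sub]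
  simp

theorem P_mul_P : A.P * A.P = A.P := prod_ext fun x y => by simp [P_toLp]

theorem adjoint_P : A.P† = A.P := by
  rw [P, adjoint_blockOp, ← ContinuousLinearMap.star_eq_adjoint, star_one]
  simp only [map_zero]

theorem adjoint_Pperp : A.Pperp† = A.Pperp := by
  rw [Pperp, map_sub, adjoint_P, ← ContinuousLinearMap.star_eq_adjoint, star_one]

theorem P_mul_Pperp : A.P * A.Pperp = 0 := by
  rw [Pperp, mul_sub, mul_one, P_mul_P, sub_self]

theorem Pperp_mul_P : A.Pperp * A.P = 0 := by
  rw [Pperp, sub_mul, one_mul, P_mul_P, sub_self]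

theorem Pperp_mul_Pperp : A.Pperp * A.Pperp = A.Pperp := by
  rw [Pperp, mul_sub, mul_one, ← Pperp, Pperp_mul_P, sub_zero]

theorem P_add_Pperp : A.P + A.Pperp = 1 := add_sub_cancel _ _

theorem inner_P_Pperp (x y : A.F) : inner ℂ (A.P x) (A.Pperp y) = 0 := by
  rw [← ContinuousLinearMap.adjoint_inner_right, adjoint_P, ← mul_apply_eq_comp, P_mul_Pperp,
    zero_apply, inner_zero_right]

theorem norm_P_sq_add_norm_Pperp_sq (x : A.F) : ‖A.P x‖ ^ 2 + ‖A.Pperp x‖ ^ 2 = ‖x‖ ^ 2 := by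
  have := norm_add_sq (𝕜 := ℂ) (A.P x) (A.Pperp x)
  rw [inner_P_Pperp, map_zero, mul_zero, add_zero] at this
  rw [← this, ← add_apply, P_add_Pperp, one_apply_eq_self]

theorem adjoint_UL_apply (x : A.F) : (A.UL†) x = A.U.symm x := by
  refine ext_inner_left ℂ fun y => ?_
  rw [ContinuousLinearMap.adjoint_inner_right, ← A.U.inner_map_map y, A.U.apply_symm_apply]
  rfl

theorem adjoint_UL_mul_UL : A.UL† * A.UL = 1 :=
  ContinuousLinearMap.ext fun x => (A.adjoint_UL_apply _).trans (A.U.symm_apply_apply x)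

theorem UL_mul_adjoint_UL : A.UL * A.UL† = 1 :=
  ContinuousLinearMap.ext fun x =>
    (congrArg A.U (A.adjoint_UL_apply x)).trans (A.U.apply_symm_apply x)

theorem norm_UL (x : A.F) : ‖A.UL x‖ = ‖x‖ := A.U.norm_map x

theorem norm_adjoint_UL (x : A.F) : ‖(A.UL†) x‖ = ‖x‖ := by
  rw [adjoint_UL_apply, A.U.symm.norm_map]

theorem inner_adjoint_UL (x y : A.F) : inner ℂ ((A.UL†) x) ((A.UL†) y) = inner ℂ x y := by
  rw [adjoint_UL_apply, adjoint_UL_apply, A.U.symm.inner_map_map]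

theorem adjoint_ΛL_comp_ΛL : A.ΛL† ∘L A.ΛL = 1 :=
  (ContinuousLinearMap.norm_map_iff_adjoint_comp_self _).1 A.Λ.norm_map

/-- The operator `Λ D_T : H → F`. -/
def ΛD : H →L[ℂ] A.F := A.ΛL ∘L defectTo (T₁ * T₂)

theorem ΛD_apply (h : H) : A.ΛD h = AndoSpace.vec A.E (defectTo T₁ (T₂ h)) (defectTo T₂ h) :=
  A.Λ_defect h

theorem UL_ΛD_apply (h : H) :
    A.UL (A.ΛD h) = AndoSpace.vec A.E (defectTo T₁ h) (defectTo T₂ (T₁ h)) := by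
  rw [ΛD_apply]
  exact A.U_vec h

theorem P_vec (x : defectSpace T₁) (y : defectSpace T₂) :
    A.P (AndoSpace.vec A.E x y) = AndoSpace.vec A.E x 0 := A.P_toLp _ _

theorem Pperp_vec (x : defectSpace T₁) (y : defectSpace T₂) :
    A.Pperp (AndoSpace.vec A.E x y) = AndoSpace.vec A.E 0 y := A.Pperp_toLp _ _

theorem vec_add (x x' : defectSpace T₁) (y y' : defectSpace T₂) :
    AndoSpace.vec A.E x y + AndoSpace.vec A.E x' y' = AndoSpace.vec A.E (x + x') (y + y') := by
  simp only [AndoSpace.vec, ← WithLp.toLp_add, Prod.mk_add_mk, add_zero]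

theorem norm_vec_sq (x : defectSpace T₁) (y : defectSpace T₂) :
    ‖AndoSpace.vec A.E x y‖ ^ 2 = ‖x‖ ^ 2 + ‖y‖ ^ 2 := by
  simp [AndoSpace.vec, WithLp.prod_norm_sq_eq_of_L2]

end AndoTuple

/-! ### The Schäffer-type model -/

section Schaffer

/-- The operator `(T 0; C M_φ)` with `φ(z) = A + zB`, where `C` has values in the constants, is an
isometry. -/
theorem norm_blockOp_const_mulOp {H F : Type*} [NormedAddCommGroup H] [InnerProductSpace ℂ H]
    [NormedAddCommGroup F] [InnerProductSpace ℂ F]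
    {T : H →L[ℂ] H} {C : H →L[ℂ] F} {A B : F →L[ℂ] F}
    (hC : ∀ x, ‖T x‖ ^ 2 + ‖C x‖ ^ 2 = ‖x‖ ^ 2) (hCA : ∀ x y, inner ℂ (C x) (A y) = 0)
    (h₀ : ∀ x y, inner ℂ (A x) (B y) = 0) (h : ∀ x, ‖A x‖ ^ 2 + ‖B x‖ ^ 2 = ‖x‖ ^ 2)
    (x : WithLp 2 (H × H2 F)) : ‖blockOp T 0 (H2.const ∘L C) (H2.mulOp A B) x‖ = ‖x‖ := by
  obtain ⟨x, f⟩ := x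
  refine (pow_left_inj₀ (norm_nonneg _) (norm_nonneg _) two_ne_zero).1 ?_
  have h₁ := norm_add_sq (𝕜 := ℂ) (H2.const (C x)) (H2.mulOp A B f)
  rw [H2.inner_const_left, H2.mulOp_zero, hCA, map_zero, mul_zero, add_zero,
    H2.norm_mulOp h₀ h, H2.norm_const] at h₁
  rw [blockOp_toLp, WithLp.prod_norm_sq_eq_of_L2, WithLp.prod_norm_sq_eq_of_L2]
  change ‖T x + 0‖ ^ 2 + ‖H2.const (C x) + H2.mulOp A B f‖ ^ 2 = ‖x‖ ^ 2 + ‖f‖ ^ 2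
  rw [add_zero, h₁, ← hC x, add_assoc]

/-- The condition `B C₂ = 0` keeps the lower left entry of the product constant: it removes the term
of degree one in `(A + zB) C₂`. -/
theorem blockOp_const_mulOp_mul {H F : Type*} [NormedAddCommGroup H] [InnerProductSpace ℂ H]
    [NormedAddCommGroup F] [InnerProductSpace ℂ F]
    {T S : H →L[ℂ] H} {C₁ C₂ G : H →L[ℂ] F} {A B C D : F →L[ℂ] F}
    (hAC : A * C = 0) (hBD : B * D = 0) (h : A * D + B * C = 1)
    (hB : ∀ x, B (C₂ x) = 0) (hG : ∀ x, C₁ (S x) + A (C₂ x) = G x) :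
    blockOp T 0 (H2.const ∘L C₁) (H2.mulOp A B) * blockOp S 0 (H2.const ∘L C₂) (H2.mulOp C D) =
      blockOp (T * S) 0 (H2.const ∘L G) H2.shift := by
  refine prod_ext fun x f => ?_
  simp only [mul_apply_eq_comp, blockOp_toLp, zero_apply, add_zero, ContinuousLinearMap.comp_apply,
    map_add, H2.mulOp_const A B (hB x), H2.mulOp_mulOp hAC hBD h, ← hG, ← add_assoc]

variable {T₁ T₂ : H →L[ℂ] H} (A : AndoTuple.{u, v} T₁ T₂)

/-- The first column is isometric because `P U Λ D_T h = D_{T₁} h ⊕ 0`. It takes values in `Ran P`,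
orthogonal to the constant term `P^⊥ U` of the symbol. -/
theorem norm_schaffer₁ (hT₁ : ‖T₁‖ ≤ 1) (x : WithLp 2 (H × H2 A.F)) : ‖schaffer₁ A x‖ = ‖x‖ := by
  refine norm_blockOp_const_mulOp (C := (A.P * A.UL) ∘L A.ΛD) (fun x => ?_) (fun x y => ?_)
    (fun x y => ?_) (fun x => ?_) x
  · rw [ContinuousLinearMap.comp_apply, mul_apply_eq_comp, A.UL_ΛD_apply, A.P_vec, A.norm_vec_sq,
      norm_defectTo_sq hT₁, norm_zero]
    ring
  · exact A.inner_P_Pperp _ _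
  · exact inner_eq_zero_symm.1 (A.inner_P_Pperp _ _)
  · rw [mul_apply_eq_comp, mul_apply_eq_comp, add_comm, A.norm_P_sq_add_norm_Pperp_sq, A.norm_UL]

theorem norm_schaffer₂ (hT₂ : ‖T₂‖ ≤ 1) (x : WithLp 2 (H × H2 A.F)) : ‖schaffer₂ A x‖ = ‖x‖ := by
  refine norm_blockOp_const_mulOp (C := (A.UL† * A.Pperp) ∘L A.ΛD) (fun x => ?_) (fun x y => ?_)
    (fun x y => ?_) (fun x => ?_) x
  · rw [ContinuousLinearMap.comp_apply, mul_apply_eq_comp, A.norm_adjoint_UL, A.ΛD_apply,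
      A.Pperp_vec, A.norm_vec_sq, norm_defectTo_sq hT₂, norm_zero]
    ring
  · exact (A.inner_adjoint_UL _ _).trans (inner_eq_zero_symm.1 (A.inner_P_Pperp _ _))
  · exact (A.inner_adjoint_UL _ _).trans (A.inner_P_Pperp _ _)
  · rw [mul_apply_eq_comp, mul_apply_eq_comp, A.norm_adjoint_UL, A.norm_adjoint_UL,
      A.norm_P_sq_add_norm_Pperp_sq]

theorem mul_mul_mul_cancel {R : Type*} [Ring R] {a b c d : R} (h : b * c = 1) :
    (a * b) * (c * d) = a * d := by
  rw [mul_assoc, ← mul_assoc b, h, one_mul]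

/-- In this order the inner factors `U U*` cancel. The lower left entry is `P U Λ D_T T₂ + P^⊥ Λ
D_T`, which reassembles `D_{T₁}T₂h ⊕ D_{T₂}h`. -/
theorem schaffer₁_mul_schaffer₂ : schaffer₁ A * schaffer₂ A =
    blockOp (T₁ * T₂) 0 (H2.const ∘L A.ΛD) H2.shift := by
  have hU := A.UL_mul_adjoint_UL
  refine blockOp_const_mulOp_mul (C₁ := (A.P * A.UL) ∘L A.ΛD) (C₂ := (A.UL† * A.Pperp) ∘L A.ΛD)
    ?_ ?_ ?_ (fun x => ?_) (fun x => ?_)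
  · rw [mul_mul_mul_cancel hU, A.Pperp_mul_P]
  · rw [mul_mul_mul_cancel hU, A.P_mul_Pperp]
  · rw [mul_mul_mul_cancel hU, mul_mul_mul_cancel hU, A.Pperp_mul_Pperp, A.P_mul_P, add_comm,
      A.P_add_Pperp]
  · rw [ContinuousLinearMap.comp_apply, ← mul_apply_eq_comp, mul_mul_mul_cancel hU, A.P_mul_Pperp,
      zero_apply]
  · rw [ContinuousLinearMap.comp_apply, ContinuousLinearMap.comp_apply,
      ← mul_apply_eq_comp (A.Pperp * A.UL), mul_mul_mul_cancel hU, A.Pperp_mul_Pperp,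
      mul_apply_eq_comp, A.UL_ΛD_apply, A.ΛD_apply, A.P_vec, A.Pperp_vec, A.vec_add, add_zero,
      zero_add]

theorem mul_mul_mul_eq_zero {R : Type*} [Ring R] {a b c d : R} (h : b * c = 0) :
    (a * b) * (c * d) = 0 := by
  rw [mul_assoc, ← mul_assoc b, h, zero_mul, mul_zero]

theorem mul_mul_mul_of_idem {R : Type*} [Ring R] {a b d : R} (h : b * b = b) :
    (a * b) * (b * d) = a * b * d := by
  rw [mul_assoc, ← mul_assoc b, h, mul_assoc]

/-- In this order the projections meet in the middle. The entry is `U* (P^⊥ Λ D_T T₁ + P U Λ D_T)`,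
where the bracket is `D_{T₁}h ⊕ D_{T₂}T₁h = U Λ D_T h`. -/
theorem schaffer₂_mul_schaffer₁ : schaffer₂ A * schaffer₁ A =
    blockOp (T₂ * T₁) 0 (H2.const ∘L A.ΛD) H2.shift := by
  refine blockOp_const_mulOp_mul (C₁ := (A.UL† * A.Pperp) ∘L A.ΛD) (C₂ := (A.P * A.UL) ∘L A.ΛD)
    ?_ ?_ ?_ (fun x => ?_) (fun x => ?_)
  · exact mul_mul_mul_eq_zero A.P_mul_Pperp
  · exact mul_mul_mul_eq_zero A.Pperp_mul_P
  · rw [mul_mul_mul_of_idem A.P_mul_P, mul_mul_mul_of_idem A.Pperp_mul_Pperp, ← add_mul,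
      ← mul_add, A.P_add_Pperp, mul_one,
      A.adjoint_UL_mul_UL]
  · rw [ContinuousLinearMap.comp_apply, ← mul_apply_eq_comp, mul_mul_mul_eq_zero A.Pperp_mul_P,
      zero_apply]
  · rw [ContinuousLinearMap.comp_apply, ContinuousLinearMap.comp_apply,
      ← mul_apply_eq_comp (A.UL† * A.P), mul_mul_mul_of_idem A.P_mul_P, mul_apply_eq_comp,
      mul_apply_eq_comp,
      mul_apply_eq_comp, ← map_add, A.UL_ΛD_apply, A.ΛD_apply, A.P_vec, A.Pperp_vec, A.vec_add,
      add_zero, zero_add, ← A.UL_ΛD_apply, ← mul_apply_eq_comp, A.adjoint_UL_mul_UL,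
      one_apply_eq_self]

/-- The embedding of `K` as the first summand of `K ⊕ L`. -/
def inlₗᵢ (K L : Type*) [NormedAddCommGroup K] [InnerProductSpace ℂ K] [NormedAddCommGroup L]
    [InnerProductSpace ℂ L] : K →ₗᵢ[ℂ] WithLp 2 (K × L) where
  toLinearMap := (WithLp.linearEquiv 2 ℂ (K × L)).symm.toLinearMap ∘ₗ LinearMap.inl ℂ K L
  norm_map' x := by
    refine (pow_left_inj₀ (norm_nonneg _) (norm_nonneg _) two_ne_zero).1 ?_
    rw [WithLp.prod_norm_sq_eq_of_L2]
    simp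

theorem inlₗᵢ_apply {K L : Type*} [NormedAddCommGroup K] [InnerProductSpace ℂ K]
    [NormedAddCommGroup L] [InnerProductSpace ℂ L] (x : K) :
    inlₗᵢ K L x = WithLp.toLp 2 (x, 0) := rfl

/-- The orbit of a subspace under `V` spans a `V`-invariant closed subspace. -/
theorem map_mem_orbit_closure {K : Type*} [NormedAddCommGroup K] [InnerProductSpace ℂ K]
    {X : Type*} {J : X → K} {V W : K →L[ℂ] K}
    (h : ∀ p : ℕ × X, W ((V ^ p.1) (J p.2)) ∈
      (Submodule.span ℂ (Set.range fun p : ℕ × X => (V ^ p.1) (J p.2))).topologicalClosure) {x : K}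
    (hx : x ∈
      (Submodule.span ℂ (Set.range fun p : ℕ × X => (V ^ p.1) (J p.2))).topologicalClosure) :
    W x ∈ (Submodule.span ℂ (Set.range fun p : ℕ × X => (V ^ p.1) (J p.2))).topologicalClosure := by
  set M := (Submodule.span ℂ (Set.range fun p : ℕ × X => (V ^ p.1) (J p.2))).topologicalClosure
  have : M ≤ M.comap W.toLinearMap := by
    refine Submodule.topologicalClosure_minimal _ (Submodule.span_le.2 ?_)
      ((Submodule.isClosed_topologicalClosure _).preimage W.continuous)
    rintro _ ⟨p, rfl⟩
    exact h p
  exact this hx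

/-- The Schäffer isometric dilation of a contraction is minimal. -/
theorem schaffer_total (T : H →L[ℂ] H) :
    (Submodule.span ℂ (Set.range fun p : ℕ × H =>
      (blockOp T 0 (H2.const ∘L defectTo T) H2.shift ^ p.1)
        (inlₗᵢ H (H2 (defectSpace T)) p.2))).topologicalClosure = ⊤ := by
  set V := blockOp T 0 (H2.const ∘L defectTo T) H2.shift
  set M := (Submodule.span ℂ (Set.range fun p : ℕ × H =>
      (V ^ p.1) (inlₗᵢ H (H2 (defectSpace T)) p.2))).topologicalClosure
  have hmem : ∀ p : ℕ × H, (V ^ p.1) (inlₗᵢ H (H2 (defectSpace T)) p.2) ∈ M := fun p =>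
    Submodule.le_topologicalClosure _ (Submodule.subset_span ⟨p, rfl⟩)
  have hV : ∀ x ∈ M, V x ∈ M := fun x => map_mem_orbit_closure fun p => by
    rw [← mul_apply_eq_comp, ← pow_succ']
    exact hmem (p.1 + 1, p.2)
  have hH : ∀ h : H, WithLp.toLp 2 (h, 0) ∈ M := fun h => hmem (0, h)
  have hMc : IsClosed (M : Set (WithLp 2 (H × H2 (defectSpace T)))) :=
    Submodule.isClosed_topologicalClosure _
  let ι : H2 (defectSpace T) →L[ℂ] WithLp 2 (H × H2 (defectSpace T)) :=
    (WithLp.prodContinuousLinearEquiv 2 ℂ _ _).symm.toContinuousLinearMap ∘L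
      ContinuousLinearMap.inr ℂ _ _
  have hι : ∀ f, ι f = WithLp.toLp 2 (0, f) := fun f => rfl
  have hN : M.comap ι.toLinearMap = ⊤ := by
    have hc : IsClosed (M.comap ι.toLinearMap : Set (H2 (defectSpace T))) :=
      hMc.preimage ι.continuous
    refine H2.eq_top_of_const_mem hc (fun f hf => ?_)
      (forall_defectSpace_mem hc H2.const fun h => ?_)
    · have := hV _ hf
      simpa [hι, V, blockOp_toLp] using this
    -- `V(h ⊕ 0) - Th ⊕ 0` is the constant function `D_T h`.
    · have := M.sub_mem (hV _ (hH h)) (hH (T h))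
      simpa [hι, V, blockOp_toLp, ← WithLp.toLp_sub] using this
  refine Submodule.eq_top_iff'.2 fun x => ?_
  have := M.add_mem (hH x.fst) ((Submodule.eq_top_iff'.1 hN) x.snd)
  rw [ContinuousLinearMap.coe_coe, hι, ← WithLp.toLp_add, Prod.mk_add_mk, add_zero,
    zero_add] at this
  exact this

theorem adjoint_blockOp_inl {K L : Type*} [NormedAddCommGroup K] [InnerProductSpace ℂ K]
    [CompleteSpace K] [NormedAddCommGroup L] [InnerProductSpace ℂ L] [CompleteSpace L]
    (S : K →L[ℂ] K) (C : K →L[ℂ] L) (D : L →L[ℂ] L) (x : K) :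
    ((blockOp S 0 C D)†) (WithLp.toLp 2 (x, 0)) = WithLp.toLp 2 ((S†) x, 0) := by
  rw [adjoint_blockOp, blockOp_toLp]
  simp only [map_zero, zero_apply, add_zero]

theorem piΛ_toLp (x : H) (f : H2 (defectSpace (T₁ * T₂))) :
    piΛ A (WithLp.toLp 2 (x, f)) = WithLp.toLp 2 (x, H2.map A.ΛL f) := by
  rw [piΛ, blockOp_toLp, zero_apply, zero_apply, add_zero, zero_add, one_apply_eq_self]

theorem adjoint_piΛ : (piΛ A)† = blockOp 1 0 0 (H2.map (A.ΛL†)) := by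
  rw [piΛ, adjoint_blockOp, H2.adjoint_map, ← ContinuousLinearMap.star_eq_adjoint, star_one,
    map_zero, map_zero]

theorem adjoint_piΛ_toLp (x : H) (f : H2 A.F) :
    ((piΛ A)†) (WithLp.toLp 2 (x, f)) = WithLp.toLp 2 (x, H2.map (A.ΛL†) f) := by
  rw [adjoint_piΛ, blockOp_toLp, zero_apply, zero_apply, add_zero, zero_add,
      one_apply_eq_self]

theorem adjoint_piΛ_comp_piΛ : (piΛ A)† ∘L piΛ A = 1 := by
  refine prod_ext fun x f => ?_
  rw [ContinuousLinearMap.comp_apply, piΛ_toLp, adjoint_piΛ_toLp, ← ContinuousLinearMap.comp_apply,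
    H2.map_comp, A.adjoint_ΛL_comp_ΛL]
  rfl

/-- Used with `M = Λ` and with `M = Λ*`; together these say that the range of `Π_Λ` reduces `V₁V₂`,
with the Schäffer dilation of `T` as the restricted operator. -/
theorem blockOp_map_comp_blockOp_const {H E F : Type*} [NormedAddCommGroup H]
    [InnerProductSpace ℂ H] [NormedAddCommGroup E] [InnerProductSpace ℂ E] [NormedAddCommGroup F]
    [InnerProductSpace ℂ F] (T : H →L[ℂ] H) {M : E →L[ℂ] F} {C : H →L[ℂ] E} {C' : H →L[ℂ] F}
    (h : ∀ x, M (C x) = C' x) :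
    blockOp 1 0 0 (H2.map M) ∘L blockOp T 0 (H2.const ∘L C) H2.shift =
      blockOp T 0 (H2.const ∘L C') H2.shift ∘L blockOp 1 0 0 (H2.map M) := by
  refine prod_ext fun x f => ?_
  simp only [ContinuousLinearMap.comp_apply, blockOp_toLp, map_add, H2.map_shift, H2.map_const, h,
    zero_apply, add_zero, zero_add, one_apply_eq_self]

theorem schaffer₁_mul_schaffer₂_comp_piΛ : (schaffer₁ A * schaffer₂ A) ∘L piΛ A =
    piΛ A ∘L blockOp (T₁ * T₂) 0 (H2.const ∘L defectTo (T₁ * T₂)) H2.shift := by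
  rw [schaffer₁_mul_schaffer₂]
  exact (blockOp_map_comp_blockOp_const _ fun x => rfl).symm

theorem adjoint_piΛ_comp_schaffer₁_mul_schaffer₂ : (piΛ A)† ∘L (schaffer₁ A * schaffer₂ A) =
    blockOp (T₁ * T₂) 0 (H2.const ∘L defectTo (T₁ * T₂)) H2.shift ∘L (piΛ A)† := by
  rw [schaffer₁_mul_schaffer₂, adjoint_piΛ]
  exact blockOp_map_comp_blockOp_const _ fun x =>
    congrArg (fun f => f (defectTo (T₁ * T₂) x)) A.adjoint_ΛL_comp_ΛL

theorem schaffer_isPseudoLift (hT₁ : ‖T₁‖ ≤ 1) (hT₂ : ‖T₂‖ ≤ 1) (hcomm : T₁ * T₂ = T₂ * T₁) :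
    IsPseudoLift T₁ T₂ (inlₗᵢ H (H2 (defectSpace (T₁ * T₂))))
      ((piΛ A)† ∘L schaffer₁ A ∘L piΛ A) ((piΛ A)† ∘L schaffer₂ A ∘L piΛ A)
      (blockOp (T₁ * T₂) 0 (H2.const ∘L defectTo (T₁ * T₂)) H2.shift) := by
  refine IsPseudoLift.compression
    ((ContinuousLinearMap.norm_map_iff_adjoint_comp_self _).1 (norm_schaffer₁ A hT₁))
    ((ContinuousLinearMap.norm_map_iff_adjoint_comp_self _).1 (norm_schaffer₂ A hT₂))
    (by rw [schaffer₁_mul_schaffer₂, schaffer₂_mul_schaffer₁, hcomm]) (adjoint_piΛ_comp_piΛ A)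
    (schaffer₁_mul_schaffer₂_comp_piΛ A) (adjoint_piΛ_comp_schaffer₁_mul_schaffer₂ A)
    (fun h => ?_) (fun h => ?_) hcomm (schaffer_total _)
  · rw [inlₗᵢ_apply, inlₗᵢ_apply, piΛ_toLp, piΛ_toLp, map_zero]
    exact adjoint_blockOp_inl _ _ _ _
  · rw [inlₗᵢ_apply, inlₗᵢ_apply, piΛ_toLp, piΛ_toLp, map_zero]
    exact adjoint_blockOp_inl _ _ _ _

/-- The compression of the product, if the compressed-to subspace is invariant. -/
theorem compressedTriple_eq {K L : Type*} [NormedAddCommGroup K] [InnerProductSpace ℂ K]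
    [CompleteSpace K] [NormedAddCommGroup L] [InnerProductSpace ℂ L] [CompleteSpace L]
    {V₁ V₂ : L →L[ℂ] L} {J : K →L[ℂ] L} {V : K →L[ℂ] K} (hJ : J† ∘L J = 1)
    (hV : (V₁ * V₂) ∘L J = J ∘L V) :
    compressedTriple V₁ V₂ J = ![J† ∘L V₁ ∘L J, J† ∘L V₂ ∘L J, V] := by
  have : J† ∘L J ∘L V = V := by
    rw [← ContinuousLinearMap.comp_assoc, hJ, ContinuousLinearMap.one_def,
      ContinuousLinearMap.id_comp]
  rw [compressedTriple, hV, this]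

end Schaffer

end

section

variable {H : Type u} [NormedAddCommGroup H] [InnerProductSpace ℂ H] [CompleteSpace H]

/-! ### The observability operator of a contraction -/

section DefectSeq

theorem sum_norm_defectTo_pow_sq {S : H →L[ℂ] H} (hS : ‖S‖ ≤ 1) (h : H) (N : ℕ) :
    ∑ n ∈ Finset.range N, ‖defectTo S ((S ^ n) h)‖ ^ 2 = ‖h‖ ^ 2 - ‖(S ^ N) h‖ ^ 2 := by
  have : ∀ n, ‖defectTo S ((S ^ n) h)‖ ^ 2 = ‖(S ^ n) h‖ ^ 2 - ‖(S ^ (n + 1)) h‖ ^ 2 := fun n => by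
    rw [norm_defectTo_sq hS, pow_succ' S, mul_apply_eq_comp]
  simp only [this]
  rw [Finset.sum_range_sub' (fun n => ‖(S ^ n) h‖ ^ 2)]
  simp

theorem hasSum_norm_defectTo_pow_sq {S : H →L[ℂ] H} (hS : ‖S‖ ≤ 1) {h : H} {c : ℝ}
    (hc : Tendsto (fun n : ℕ => ‖(S ^ n) h‖ ^ 2) atTop (𝓝 c)) :
    HasSum (fun n => ‖defectTo S ((S ^ n) h)‖ ^ 2) (‖h‖ ^ 2 - c) := by
  rw [hasSum_iff_tendsto_nat_of_nonneg (fun n => by positivity)]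
  simp only [sum_norm_defectTo_pow_sq hS]
  exact tendsto_const_nhds.sub hc

theorem summable_norm_defectTo_pow_sq {S : H →L[ℂ] H} (hS : ‖S‖ ≤ 1) (h : H) :
    Summable fun n => ‖defectTo S ((S ^ n) h)‖ ^ 2 :=
  summable_of_sum_range_le (fun n => by positivity) fun N => by
    rw [sum_norm_defectTo_pow_sq hS]
    exact sub_le_self _ (by positivity)

/-- The observability operator `h ↦ (D_S Sⁿ h)ₙ` of a contraction `S`. -/
def defectSeq (S : H →L[ℂ] H) (hS : ‖S‖ ≤ 1) : H →ₗ[ℂ] H2 (defectSpace S) where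
  toFun h := ⟨fun n => defectTo S ((S ^ n) h),
    H2.memlp_of_summable (summable_norm_defectTo_pow_sq hS h)⟩
  map_add' h k := by ext n; exact congrArg Subtype.val ((defectTo S ∘L S ^ n).map_add h k)
  map_smul' c h := by ext n; exact congrArg Subtype.val ((defectTo S ∘L S ^ n).map_smul c h)

theorem defectSeq_apply (S : H →L[ℂ] H) (hS : ‖S‖ ≤ 1) (h : H) (n : ℕ) :
    defectSeq S hS h n = defectTo S ((S ^ n) h) := rfl

theorem adjoint_shift_defectSeq (S : H →L[ℂ] H) (hS : ‖S‖ ≤ 1) (h : H) :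
    (H2.shift†) (defectSeq S hS h) = defectSeq S hS (S h) := by
  ext n
  rw [H2.adjoint_shift_apply, defectSeq_apply, defectSeq_apply, pow_succ, mul_apply_eq_comp]

/-- Isolates the zeroth coefficient, so that `J h - V V* J h` becomes a constant function in the
minimality proof. -/
theorem defectSeq_eq_const_add (S : H →L[ℂ] H) (hS : ‖S‖ ≤ 1) (h : H) :
    defectSeq S hS h = H2.const (defectTo S h) + H2.shift (defectSeq S hS (S h)) := by
  ext n
  rcases n with _ | n
  · simp [defectSeq_apply]
  · simp [defectSeq_apply, pow_succ]

end DefectSeq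

section Diagonal

variable {K L K' L' : Type*} [NormedAddCommGroup K] [InnerProductSpace ℂ K]
  [NormedAddCommGroup L] [InnerProductSpace ℂ L] [NormedAddCommGroup K'] [InnerProductSpace ℂ K']
  [NormedAddCommGroup L'] [InnerProductSpace ℂ L']

theorem blockOp_diag_toLp (A : K →L[ℂ] K') (B : L →L[ℂ] L') (x : K) (y : L) :
    blockOp A 0 0 B (WithLp.toLp 2 (x, y)) = WithLp.toLp 2 (A x, B y) := by
  simp only [blockOp_toLp, zero_apply, add_zero, zero_add]

theorem blockOp_diag_comp {K'' L'' : Type*} [NormedAddCommGroup K''] [InnerProductSpace ℂ K'']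
    [NormedAddCommGroup L''] [InnerProductSpace ℂ L''] (A' : K' →L[ℂ] K'') (B' : L' →L[ℂ] L'')
    (A : K →L[ℂ] K') (B : L →L[ℂ] L') :
    blockOp A' 0 0 B' ∘L blockOp A 0 0 B = blockOp (A' ∘L A) 0 0 (B' ∘L B) :=
  prod_ext fun x y => by simp only [ContinuousLinearMap.comp_apply, blockOp_diag_toLp]

theorem norm_blockOp_diag {A : K →L[ℂ] K'} {B : L →L[ℂ] L'} (hA : ∀ x, ‖A x‖ = ‖x‖)
    (hB : ∀ x, ‖B x‖ = ‖x‖) (x : WithLp 2 (K × L)) : ‖blockOp A 0 0 B x‖ = ‖x‖ := by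
  obtain ⟨x, y⟩ := x
  refine (pow_left_inj₀ (norm_nonneg _) (norm_nonneg _) two_ne_zero).1 ?_
  rw [blockOp_diag_toLp, WithLp.prod_norm_sq_eq_of_L2, WithLp.prod_norm_sq_eq_of_L2]
  change ‖A x‖ ^ 2 + ‖B y‖ ^ 2 = ‖x‖ ^ 2 + ‖y‖ ^ 2
  rw [hA, hB]

theorem adjoint_blockOp_diag [CompleteSpace K] [CompleteSpace L] [CompleteSpace K']
    [CompleteSpace L'] (A : K →L[ℂ] K') (B : L →L[ℂ] L') :
    (blockOp A 0 0 B)† = blockOp (A†) 0 0 (B†) := by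
  rw [adjoint_blockOp, map_zero, map_zero]

end Diagonal

/-! ### The Douglas model -/

section DouglasModel

variable {R : Type*} [NormedAddCommGroup R] [InnerProductSpace ℂ R] {S : H →L[ℂ] H}

/-- The Douglas embedding `h ↦ (D_S Sⁿ h)ₙ ⊕ qh`, for the contraction `S = T*`. -/
def douglasEmbedding (hS : ‖S‖ ≤ 1) (q : H →L[ℂ] R)
    (hq : ∀ h, Tendsto (fun n : ℕ => ‖(S ^ n) h‖ ^ 2) atTop (𝓝 (‖q h‖ ^ 2))) :
    H →ₗᵢ[ℂ] WithLp 2 (H2 (defectSpace S) × R) where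
  toLinearMap := (WithLp.linearEquiv 2 ℂ _).symm.toLinearMap ∘ₗ
    (defectSeq _ hS).prod q.toLinearMap
  norm_map' h := by
    refine (pow_left_inj₀ (norm_nonneg _) (norm_nonneg _) two_ne_zero).1 ?_
    rw [WithLp.prod_norm_sq_eq_of_L2]
    change ‖defectSeq _ hS h‖ ^ 2 + ‖q h‖ ^ 2 = ‖h‖ ^ 2
    rw [H2.norm_sq]
    refine (congrArg (· + _) (hasSum_norm_defectTo_pow_sq hS (hq h)).tsum_eq).trans ?_
    exact sub_add_cancel _ _

variable (hS : ‖S‖ ≤ 1) (q : H →L[ℂ] R)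
    (hq : ∀ h, Tendsto (fun n : ℕ => ‖(S ^ n) h‖ ^ 2) atTop (𝓝 (‖q h‖ ^ 2)))

theorem douglasEmbedding_apply (h : H) :
    douglasEmbedding hS q hq h = WithLp.toLp 2 (defectSeq _ hS h, q h) := rfl

/-- The Douglas isometric dilation of a contraction is minimal. -/
theorem douglas_total [CompleteSpace R] (W : R →L[ℂ] R) (hWW : W† * W = 1) (hWW' : W * W† = 1)
    (hW : ∀ h, (W†) (q h) = q (S h))
    (hR : ∀ N : Submodule ℂ R, IsClosed (N : Set R) → (∀ x ∈ N, W x ∈ N) → (∀ x ∈ N, (W†) x ∈ N) →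
      (∀ h, q h ∈ N) → N = ⊤) :
    (Submodule.span ℂ (Set.range fun p : ℕ × H =>
      (blockOp H2.shift 0 0 W ^ p.1) (douglasEmbedding hS q hq p.2))).topologicalClosure = ⊤ := by
  set V := blockOp (H2.shift (F := defectSpace S)) 0 0 W with hVdef
  set M := (Submodule.span ℂ (Set.range fun p : ℕ × H =>
      (V ^ p.1) (douglasEmbedding hS q hq p.2))).topologicalClosure
  have hmem : ∀ p : ℕ × H, (V ^ p.1) (douglasEmbedding hS q hq p.2) ∈ M := fun p =>
    Submodule.le_topologicalClosure _ (Submodule.subset_span ⟨p, rfl⟩)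
  have hJ : ∀ h, douglasEmbedding hS q hq h ∈ M := fun h => hmem (0, h)
  have hV : ∀ x ∈ M, V x ∈ M := fun x => map_mem_orbit_closure fun p => by
    rw [← mul_apply_eq_comp, ← pow_succ']
    exact hmem (p.1 + 1, p.2)
  have hVapp : ∀ f r, V (WithLp.toLp 2 (f, r)) = WithLp.toLp 2 (H2.shift f, W r) :=
    fun f r => blockOp_diag_toLp _ _ _ _
  have hVadj : ∀ f r, (V†) (WithLp.toLp 2 (f, r)) =
      WithLp.toLp 2 ((H2.shift†) f, (W†) r) := fun f r => by
    rw [hVdef, adjoint_blockOp_diag, blockOp_diag_toLp]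
  have hVJ : ∀ h, (V†) (douglasEmbedding hS q hq h) = douglasEmbedding hS q hq (S h) := fun h => by
    rw [douglasEmbedding_apply, hVadj, adjoint_shift_defectSeq, hW]
    rfl
  have hVV : V† * V = 1 := by
    rw [hVdef, adjoint_blockOp_diag, ContinuousLinearMap.mul_def, blockOp_diag_comp,
      H2.adjoint_shift_comp_shift, ← ContinuousLinearMap.mul_def, hWW, blockOp_one]
  -- The orbit space even reduces `V`: `V*` lowers a positive power by one and sends `J h` to `J S
  -- h`.
  have hV' : ∀ x ∈ M, (V†) x ∈ M := fun x => map_mem_orbit_closure fun p => by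
    obtain ⟨n, h⟩ := p
    cases n with
    | zero =>
      rw [pow_zero, one_apply_eq_self, hVJ]
      exact hJ _
    | succ n =>
      rw [pow_succ', ← mul_apply_eq_comp, ← mul_assoc, hVV, one_mul]
      exact hmem (n, h)
  have hMc : IsClosed (M : Set (WithLp 2 (H2 (defectSpace S) × R))) :=
    Submodule.isClosed_topologicalClosure _
  let ι₁ : H2 (defectSpace S) →L[ℂ] WithLp 2 (H2 (defectSpace S) × R) :=
    (WithLp.prodContinuousLinearEquiv 2 ℂ _ _).symm.toContinuousLinearMap ∘L
      ContinuousLinearMap.inl ℂ _ _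
  have hι₁ : ∀ f, ι₁ f = WithLp.toLp 2 (f, 0) := fun f => rfl
  let ι₂ : R →L[ℂ] WithLp 2 (H2 (defectSpace S) × R) :=
    (WithLp.prodContinuousLinearEquiv 2 ℂ _ _).symm.toContinuousLinearMap ∘L
      ContinuousLinearMap.inr ℂ _ _
  have hι₂ : ∀ f, ι₂ f = WithLp.toLp 2 (0, f) := fun f => rfl
  have hN₁ : M.comap ι₁.toLinearMap = ⊤ := by
    have hc : IsClosed (M.comap ι₁.toLinearMap : Set (H2 (defectSpace S))) :=
      hMc.preimage ι₁.continuous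
    refine H2.eq_top_of_const_mem hc (fun f hf => ?_)
      (forall_defectSpace_mem hc H2.const fun h => ?_)
    · have := hV _ hf
      rwa [ContinuousLinearMap.coe_coe, hι₁, hVapp, map_zero] at this
    -- The defect `(1 - V V*) J h` has no component in `R`, as `W W* = 1`; its Hardy component is
    -- the constant `D_S h`.
    · have := M.sub_mem (hJ h) (hV _ (hV' _ (hJ h)))
      rwa [hVJ, douglasEmbedding_apply, douglasEmbedding_apply, hVapp, ← hW, ← mul_apply_eq_comp W,
        hWW', one_apply_eq_self, ← WithLp.toLp_sub, Prod.mk_sub_mk, sub_self,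
        sub_eq_of_eq_add (defectSeq_eq_const_add S hS h)] at this
  have hN₂ : M.comap ι₂.toLinearMap = ⊤ := by
    refine hR _ (hMc.preimage ι₂.continuous) (fun x hx => ?_) (fun x hx => ?_) fun h => ?_
    · have := hV _ hx
      rwa [ContinuousLinearMap.coe_coe, hι₂, hVapp, map_zero] at this
    · have := hV' _ hx
      rwa [ContinuousLinearMap.coe_coe, hι₂, hVadj, map_zero] at this
    -- With the whole Hardy summand available, the Hardy part of `J h` can be subtracted, leaving `0
    -- ⊕ q h`.
    · have := M.sub_mem (hJ h) (Submodule.eq_top_iff'.1 hN₁ (defectSeq _ hS h))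
      rwa [ContinuousLinearMap.coe_coe, hι₁, douglasEmbedding_apply, ← WithLp.toLp_sub,
        Prod.mk_sub_mk, sub_self, sub_zero] at this
  refine Submodule.eq_top_iff'.2 fun x => ?_
  have := M.add_mem (Submodule.eq_top_iff'.1 hN₁ x.fst) (Submodule.eq_top_iff'.1 hN₂ x.snd)
  rw [ContinuousLinearMap.coe_coe, ContinuousLinearMap.coe_coe, hι₁, hι₂, ← WithLp.toLp_add,
    Prod.mk_add_mk, add_zero, zero_add] at this
  exact this

theorem blockOp_map_comp_blockOp_shift {E F R : Type*} [NormedAddCommGroup E]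
    [InnerProductSpace ℂ E] [NormedAddCommGroup F] [InnerProductSpace ℂ F] [NormedAddCommGroup R]
    [InnerProductSpace ℂ R] (M : E →L[ℂ] F) (W : R →L[ℂ] R) :
    blockOp (H2.map M) 0 0 1 ∘L blockOp H2.shift 0 0 W =
      blockOp H2.shift 0 0 W ∘L blockOp (H2.map M) 0 0 1 := by
  refine prod_ext fun f r => ?_
  simp only [ContinuousLinearMap.comp_apply, blockOp_diag_toLp, H2.map_shift, one_apply_eq_self]

theorem blockOp_diag_mul_eq_shift {F R : Type*} [NormedAddCommGroup F] [InnerProductSpace ℂ F]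
    [NormedAddCommGroup R] [InnerProductSpace ℂ R] {M₁ M₂ : H2 F →L[ℂ] H2 F} {W₁ W₂ : R →L[ℂ] R}
    (hM : ∀ f, M₁ (M₂ f) = H2.shift f) :
    blockOp M₁ 0 0 W₁ * blockOp M₂ 0 0 W₂ = blockOp H2.shift 0 0 (W₁ * W₂) :=
  prod_ext fun f r => by simp only [mul_apply_eq_comp, blockOp_diag_toLp, hM]

variable {F : Type*} [NormedAddCommGroup F] [InnerProductSpace ℂ F] [CompleteSpace F]
  [CompleteSpace R] {Λ : defectSpace S →L[ℂ] F} {M₁ M₂ : H2 F →L[ℂ] H2 F} {W₁ W₂ : R →L[ℂ] R}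
  {Φ : WithLp 2 (H2 (defectSpace S) × R) →L[ℂ] WithLp 2 (H2 F × R)}

theorem adjoint_blockOp_map : (blockOp (H2.map Λ) 0 0 (1 : R →L[ℂ] R))† =
    blockOp (H2.map (Λ†)) 0 0 1 := by
  rw [adjoint_blockOp_diag, H2.adjoint_map, ← ContinuousLinearMap.star_eq_adjoint (1 : R →L[ℂ] R),
    star_one]

theorem adjoint_blockOp_map_comp (hΛ : Λ† ∘L Λ = 1) : (blockOp (H2.map Λ) 0 0 (1 : R →L[ℂ] R))† ∘L
    blockOp (H2.map Λ) 0 0 (1 : R →L[ℂ] R) = 1 := by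
  rw [adjoint_blockOp_map, blockOp_diag_comp, H2.map_comp, hΛ, H2.map_one]
  exact blockOp_one

theorem compressedTriple_douglas (hΦ : Φ = blockOp (H2.map Λ) 0 0 1) (hΛ : Λ† ∘L Λ = 1)
    (hM : ∀ f, M₁ (M₂ f) = H2.shift f) :
    compressedTriple (blockOp M₁ 0 0 W₁) (blockOp M₂ 0 0 W₂) Φ =
      ![Φ† ∘L blockOp M₁ 0 0 W₁ ∘L Φ, Φ† ∘L blockOp M₂ 0 0 W₂ ∘L Φ,
        blockOp H2.shift 0 0 (W₁ * W₂)] := by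
  subst hΦ
  refine compressedTriple_eq (adjoint_blockOp_map_comp hΛ) ?_
  rw [blockOp_diag_mul_eq_shift hM, blockOp_map_comp_blockOp_shift]

theorem douglas_isPseudoLift {T₁ T₂ : H →L[ℂ] H} (hcomm : T₁ * T₂ = T₂ * T₁)
    (hΦ : Φ = blockOp (H2.map Λ) 0 0 1) (hΛ : Λ† ∘L Λ = 1)
    (hM₁ : ∀ f, ‖M₁ f‖ = ‖f‖) (hM₂ : ∀ f, ‖M₂ f‖ = ‖f‖)
    (hM : ∀ f, M₁ (M₂ f) = H2.shift f) (hM' : ∀ f, M₂ (M₁ f) = H2.shift f)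
    (hW₁ : ∀ r, ‖W₁ r‖ = ‖r‖) (hW₂ : ∀ r, ‖W₂ r‖ = ‖r‖) (hW : W₁ * W₂ = W₂ * W₁)
    (hq₁ : ∀ h, (W₁†) (q h) = q ((T₁†) h)) (hq₂ : ∀ h, (W₂†) (q h) = q ((T₂†) h))
    (h₁ : ∀ h, (M₁†) (H2.map Λ (defectSeq S hS h)) = H2.map Λ (defectSeq S hS ((T₁†) h)))
    (h₂ : ∀ h, (M₂†) (H2.map Λ (defectSeq S hS h)) = H2.map Λ (defectSeq S hS ((T₂†) h)))
    (ht : (Submodule.span ℂ (Set.range fun p : ℕ × H => (blockOp H2.shift 0 0 (W₁ * W₂) ^ p.1)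
        (douglasEmbedding hS q hq p.2))).topologicalClosure = ⊤) :
    IsPseudoLift T₁ T₂ (douglasEmbedding hS q hq)
      (Φ† ∘L blockOp M₁ 0 0 W₁ ∘L Φ) (Φ† ∘L blockOp M₂ 0 0 W₂ ∘L Φ)
      (blockOp H2.shift 0 0 (W₁ * W₂)) := by
  subst hΦ
  refine IsPseudoLift.compression
    ((ContinuousLinearMap.norm_map_iff_adjoint_comp_self _).1 (norm_blockOp_diag hM₁ hW₁))
    ((ContinuousLinearMap.norm_map_iff_adjoint_comp_self _).1 (norm_blockOp_diag hM₂ hW₂))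
    (by rw [blockOp_diag_mul_eq_shift hM, blockOp_diag_mul_eq_shift hM', hW])
    (adjoint_blockOp_map_comp hΛ)
    (by rw [blockOp_diag_mul_eq_shift hM, blockOp_map_comp_blockOp_shift])
    (by rw [blockOp_diag_mul_eq_shift hM, adjoint_blockOp_map, blockOp_map_comp_blockOp_shift])
    (fun h => ?_) (fun h => ?_) hcomm ht
  · rw [adjoint_blockOp_diag, douglasEmbedding_apply, douglasEmbedding_apply, blockOp_diag_toLp,
      blockOp_diag_toLp, blockOp_diag_toLp, one_apply_eq_self, one_apply_eq_self, h₁, hq₁]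
  · rw [adjoint_blockOp_diag, douglasEmbedding_apply, douglasEmbedding_apply, blockOp_diag_toLp,
      blockOp_diag_toLp, blockOp_diag_toLp, one_apply_eq_self, one_apply_eq_self, h₂, hq₂]

end DouglasModel

theorem adjoint_mul (A B : H →L[ℂ] H) : (A * B)† = B† * A† :=
  ContinuousLinearMap.adjoint_comp A B

/-! ### The symbols of the Douglas-type dilation -/

namespace AndoTuple

variable {T₁ T₂ : H →L[ℂ] H} (A : AndoTuple.{u, v} T₁ T₂)

/-- One coefficient of the lifting relation for the first symbol: the sum is `0 ⊕ D_{T₂}T₁k` plus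
`D_{T₁}T₂T₁k ⊕ 0`, that is, `Λ D_T` at `T₁k`. In the application the tuple belongs to `(T₁*, T₂*)`.
-/
theorem Pperp_UL_add_P_UL (hcomm : T₁ * T₂ = T₂ * T₁) (k : H) :
    A.Pperp (A.UL (A.ΛD k)) + A.P (A.UL (A.ΛD ((T₁ * T₂) k))) = A.ΛD (T₁ k) := by
  rw [UL_ΛD_apply, UL_ΛD_apply, Pperp_vec, P_vec, vec_add, ΛD_apply, zero_add, add_zero, hcomm,
    mul_apply_eq_comp]

theorem adjoint_UL_P_add_adjoint_UL_Pperp (k : H) :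
    (A.UL†) (A.P (A.ΛD k)) + (A.UL†) (A.Pperp (A.ΛD ((T₁ * T₂) k))) = A.ΛD (T₂ k) := by
  rw [ΛD_apply, ΛD_apply, Pperp_vec, P_vec, ← map_add, vec_add, zero_add, add_zero,
    mul_apply_eq_comp, ← UL_ΛD_apply, ← mul_apply_eq_comp, adjoint_UL_mul_UL, one_apply_eq_self]

theorem adjoint_mulOp_map_defectSeq₁ (hcomm : T₁ * T₂ = T₂ * T₁) (hT : ‖T₁ * T₂‖ ≤ 1) (h : H) :
    ((H2.mulOp (A.UL† * A.Pperp) (A.UL† * A.P))†) (H2.map A.ΛL (defectSeq _ hT h)) =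
      H2.map A.ΛL (defectSeq _ hT (T₁ h)) := by
  refine lp.ext (funext fun n => ?_)
  have hc : ((T₁ * T₂) ^ n) (T₁ h) = T₁ (((T₁ * T₂) ^ n) h) := by
    rw [← mul_apply_eq_comp, ← mul_apply_eq_comp]
    have : Commute T₁ (T₁ * T₂) := by
      rw [commute_iff_eq, mul_assoc, ← hcomm]
    rw [(this.pow_right n).eq]
  rw [H2.adjoint_mulOp_apply, H2.map_apply, H2.map_apply, H2.map_apply, defectSeq_apply,
    defectSeq_apply, defectSeq_apply, adjoint_mul, adjoint_mul, ContinuousLinearMap.adjoint_adjoint,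
    adjoint_P, adjoint_Pperp, hc, pow_succ', mul_apply_eq_comp (T₁ * T₂)]
  exact A.Pperp_UL_add_P_UL hcomm _

theorem adjoint_mulOp_map_defectSeq₂ (hcomm : T₁ * T₂ = T₂ * T₁) (hT : ‖T₁ * T₂‖ ≤ 1) (h : H) :
    ((H2.mulOp (A.P * A.UL) (A.Pperp * A.UL))†) (H2.map A.ΛL (defectSeq _ hT h)) =
      H2.map A.ΛL (defectSeq _ hT (T₂ h)) := by
  refine lp.ext (funext fun n => ?_)
  have hc : ((T₁ * T₂) ^ n) (T₂ h) = T₂ (((T₁ * T₂) ^ n) h) := by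
    rw [← mul_apply_eq_comp, ← mul_apply_eq_comp]
    have : Commute T₂ (T₁ * T₂) := by
      rw [commute_iff_eq, ← mul_assoc, ← hcomm]
    rw [(this.pow_right n).eq]
  rw [H2.adjoint_mulOp_apply, H2.map_apply, H2.map_apply, H2.map_apply, defectSeq_apply,
    defectSeq_apply, defectSeq_apply, adjoint_mul, adjoint_mul, adjoint_P, adjoint_Pperp, hc,
    pow_succ', mul_apply_eq_comp (T₁ * T₂)]
  exact A.adjoint_UL_P_add_adjoint_UL_Pperp _

theorem norm_mulOp_adjoint_UL (f : H2 A.F) :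
    ‖H2.mulOp (A.UL† * A.Pperp) (A.UL† * A.P) f‖ = ‖f‖ := by
  refine H2.norm_mulOp (fun x y => ?_) (fun x => ?_) f
  · exact (A.inner_adjoint_UL _ _).trans (inner_eq_zero_symm.1 (A.inner_P_Pperp _ _))
  · rw [mul_apply_eq_comp, mul_apply_eq_comp, A.norm_adjoint_UL, A.norm_adjoint_UL, add_comm,
      A.norm_P_sq_add_norm_Pperp_sq]

theorem norm_mulOp_UL (f : H2 A.F) : ‖H2.mulOp (A.P * A.UL) (A.Pperp * A.UL) f‖ = ‖f‖ := by
  refine H2.norm_mulOp (fun x y => ?_) (fun x => ?_) f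
  · rw [mul_apply_eq_comp, mul_apply_eq_comp, A.inner_P_Pperp]
  · rw [mul_apply_eq_comp, mul_apply_eq_comp, A.norm_P_sq_add_norm_Pperp_sq, A.norm_UL]

theorem mulOp_adjoint_UL_mulOp_UL (f : H2 A.F) :
    H2.mulOp (A.UL† * A.Pperp) (A.UL† * A.P) (H2.mulOp (A.P * A.UL) (A.Pperp * A.UL) f) =
      H2.shift f := by
  refine H2.mulOp_mulOp (mul_mul_mul_eq_zero A.Pperp_mul_P) (mul_mul_mul_eq_zero A.P_mul_Pperp)
    ?_ f
  rw [mul_mul_mul_of_idem A.P_mul_P, mul_mul_mul_of_idem A.Pperp_mul_Pperp, ← add_mul, ← mul_add,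
    add_comm, A.P_add_Pperp, mul_one, A.adjoint_UL_mul_UL]

theorem mulOp_UL_mulOp_adjoint_UL (f : H2 A.F) :
    H2.mulOp (A.P * A.UL) (A.Pperp * A.UL) (H2.mulOp (A.UL† * A.Pperp) (A.UL† * A.P) f) =
      H2.shift f := by
  have hU := A.UL_mul_adjoint_UL
  refine H2.mulOp_mulOp ?_ ?_ ?_ f
  · rw [mul_mul_mul_cancel hU, A.P_mul_Pperp]
  · rw [mul_mul_mul_cancel hU, A.Pperp_mul_P]
  · rw [mul_mul_mul_cancel hU, mul_mul_mul_cancel hU, A.Pperp_mul_Pperp, A.P_mul_P, A.P_add_Pperp]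

end AndoTuple

/-- Pairing the strong limit with `h` turns `Tⁿ T*ⁿ` into `‖T*ⁿ h‖²` and `Q²` into `‖Qh‖²`. This
makes the Douglas embedding isometric. -/
theorem tendsto_norm_pow_of_strong_limit {T Q : H →L[ℂ] H} (hQ₀ : 0 ≤ Q) {h : H}
    (hQ : Tendsto (fun n : ℕ => (T ^ n * (T†) ^ n) h) atTop (𝓝 ((Q * Q) h))) :
    Tendsto (fun n : ℕ => ‖((T†) ^ n) h‖ ^ 2) atTop (𝓝 (‖Q h‖ ^ 2)) := by
  have h₁ : ∀ n : ℕ, inner ℂ h ((T ^ n * (T†) ^ n) h) =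
      ((‖((T†) ^ n) h‖ ^ 2 : ℝ) : ℂ) := fun n => by
    rw [mul_apply_eq_comp, ← ContinuousLinearMap.adjoint_inner_left,
      ← ContinuousLinearMap.star_eq_adjoint (T ^ n), star_pow,
      ContinuousLinearMap.star_eq_adjoint, inner_self_eq_norm_sq_to_K]
    simp
  have h₂ : inner ℂ h ((Q * Q) h) = ((‖Q h‖ ^ 2 : ℝ) : ℂ) := by
    rw [mul_apply_eq_comp, ← ContinuousLinearMap.adjoint_inner_left,
      ← ContinuousLinearMap.star_eq_adjoint, hQ₀.isSelfAdjoint.star_eq, inner_self_eq_norm_sq_to_K]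
    simp
  have := (tendsto_const_nhds (x := h)).inner (𝕜 := ℂ) hQ
  simp only [h₁, h₂] at this
  exact Complex.continuous_re.tendsto _ |>.comp this

theorem denseRange_codRestrict_range {H : Type*} [NormedAddCommGroup H] [InnerProductSpace ℂ H]
    (Q : H →L[ℂ] H) :
    DenseRange (Q.codRestrict Q.range.topologicalClosure
      (fun h => Submodule.le_topologicalClosure _ (LinearMap.mem_range_self _ h))) := by
  rintro ⟨x, hx⟩
  rw [closure_subtype]
  refine closure_mono ?_ hx
  rintro _ ⟨h, rfl⟩
  exact ⟨_, ⟨h, rfl⟩, rfl⟩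

/-! ### The residual part and minimality of the Douglas lift -/

namespace DouglasResidual

variable {T₁ T₂ : H →L[ℂ] H} (D : DouglasResidual.{u, w} T₁ T₂)

theorem adjoint_W₁L_apply (x : D.R) : (D.W₁L†) x = D.W₁.symm x := by
  refine ext_inner_left ℂ fun y => ?_
  rw [ContinuousLinearMap.adjoint_inner_right, ← D.W₁.inner_map_map y, D.W₁.apply_symm_apply]
  rfl

theorem adjoint_W₂L_apply (x : D.R) : (D.W₂L†) x = D.W₂.symm x := by
  refine ext_inner_left ℂ fun y => ?_
  rw [ContinuousLinearMap.adjoint_inner_right, ← D.W₂.inner_map_map y, D.W₂.apply_symm_apply]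
  rfl

/-- The operator `Q : H → R`. -/
def ιQ : H →L[ℂ] D.R :=
  D.ι.toContinuousLinearMap ∘L D.Q.codRestrict D.Q.range.topologicalClosure
    (fun h => Submodule.le_topologicalClosure _ (LinearMap.mem_range_self _ h))

theorem norm_ιQ (h : H) : ‖D.ιQ h‖ = ‖D.Q h‖ := D.ι.norm_map _

theorem W₁_symm_ιQ (h : H) : D.W₁.symm (D.ιQ h) = D.ιQ ((T₁†) h) := D.W₁_extends h

theorem W₂_symm_ιQ (h : H) : D.W₂.symm (D.ιQ h) = D.ιQ ((T₂†) h) := D.W₂_extends h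

theorem W₁L_mul_W₂L : D.W₁L * D.W₂L = D.W₂L * D.W₁L :=
  ContinuousLinearMap.ext fun x => congrArg (fun f => f x) D.W_comm

theorem adjoint_W₁L_mul_W₂L_apply (x : D.R) :
    ((D.W₁L * D.W₂L)†) x = D.W₂.symm (D.W₁.symm x) := by
  rw [adjoint_mul, mul_apply_eq_comp, adjoint_W₁L_apply, adjoint_W₂L_apply]

theorem norm_pow_tendsto (h : H) :
    Tendsto (fun n : ℕ => ‖(((T₁ * T₂)†) ^ n) h‖ ^ 2) atTop (𝓝 (‖D.Q h‖ ^ 2)) :=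
  tendsto_norm_pow_of_strong_limit D.Q_nonneg (D.Q_tendsto h)

theorem eq_top_of_ιQ_mem {N : Submodule ℂ D.R} (hN : IsClosed (N : Set D.R))
    (hW : ∀ x ∈ N, D.W₁ (D.W₂ x) ∈ N) (hW' : ∀ x ∈ N, D.W₂.symm (D.W₁.symm x) ∈ N)
    (hQ : ∀ h, D.ιQ h ∈ N) : N = ⊤ := by
  have hι : ∀ x, D.ι x ∈ N := by
    exact fun x => (denseRange_codRestrict_range D.Q).induction (P := fun x => D.ι x ∈ N)
      (by rintro _ ⟨h, rfl⟩; exact hQ h)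
      (hN.preimage D.ι.continuous) x
  rw [eq_top_iff, ← D.minimal]
  refine Submodule.topologicalClosure_minimal _ (Submodule.span_le.2 ?_) hN
  rintro _ ⟨n, x, rfl⟩
  induction n with
  | zero => exact hι x
  | succ n ih =>
    rw [add_comm, zpow_add, zpow_one]
    exact hW _ ih
  | pred n ih =>
    rw [sub_eq_add_neg, add_comm, zpow_add, zpow_neg_one]
    exact hW' _ ih

end DouglasResidual

section Douglas

variable {T₁ T₂ : H →L[ℂ] H} (B : AndoTuple.{u, v} (T₁†) (T₂†)) (D : DouglasResidual.{u, w} T₁ T₂)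

theorem norm_adjoint_mul_adjoint_le_one (hT₁ : ‖T₁‖ ≤ 1) (hT₂ : ‖T₂‖ ≤ 1) :
    ‖T₁† * T₂†‖ ≤ 1 :=
  norm_mul_le_one (by rwa [LinearIsometryEquiv.norm_map]) (by rwa [LinearIsometryEquiv.norm_map])

theorem adjoint_mul_adjoint (hcomm : T₁ * T₂ = T₂ * T₁) : T₁† * T₂† = (T₁ * T₂)† := by
  rw [hcomm, adjoint_mul]

theorem adjoint_comm (hcomm : T₁ * T₂ = T₂ * T₁) : T₁† * T₂† = T₂† * T₁† := by
  rw [adjoint_mul_adjoint hcomm, adjoint_mul]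

theorem douglas_residual_total (hcomm : T₁ * T₂ = T₂ * T₁) (hT : ‖T₁† * T₂†‖ ≤ 1)
    (hq : ∀ h, Tendsto (fun n : ℕ => ‖((T₁† * T₂†) ^ n) h‖ ^ 2) atTop (𝓝 (‖D.ιQ h‖ ^ 2))) :
    (Submodule.span ℂ (Set.range fun p : ℕ × H =>
      (blockOp H2.shift 0 0 (D.W₁L * D.W₂L) ^ p.1)
        (douglasEmbedding hT D.ιQ hq p.2))).topologicalClosure = ⊤ := by
  refine douglas_total hT D.ιQ hq (D.W₁L * D.W₂L) (ContinuousLinearMap.ext fun x => ?_)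
    (ContinuousLinearMap.ext fun x => ?_) (fun h => ?_) (fun N hN hW hW' hQ => ?_)
  · rw [mul_apply_eq_comp, D.adjoint_W₁L_mul_W₂L_apply]
    exact (congrArg D.W₂.symm (D.W₁.symm_apply_apply _)).trans (D.W₂.symm_apply_apply _)
  · rw [mul_apply_eq_comp, D.adjoint_W₁L_mul_W₂L_apply]
    exact (congrArg D.W₁ (D.W₂.apply_symm_apply _)).trans (D.W₁.apply_symm_apply _)
  · rw [D.adjoint_W₁L_mul_W₂L_apply, D.W₁_symm_ιQ, D.W₂_symm_ιQ, adjoint_comm hcomm,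
      mul_apply_eq_comp]
  · exact D.eq_top_of_ιQ_mem hN hW (fun x hx => D.adjoint_W₁L_mul_W₂L_apply x ▸ hW' x hx) hQ

end Douglas

end

/-! ### The unitary equivalence -/

section

variable {H : Type u} [NormedAddCommGroup H] [InnerProductSpace ℂ H] [CompleteSpace H]

set_option maxHeartbeats 2000000 in
theorem unitarilyEquivalent_schaffer_douglas {T₁ T₂ : H →L[ℂ] H} (hT₁ : ‖T₁‖ ≤ 1) (hT₂ : ‖T₂‖ ≤ 1)
    (hcomm : T₁ * T₂ = T₂ * T₁) (A : AndoTuple.{u, v₁} T₁ T₂)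
    (B : AndoTuple.{u, v₂} (T₁†) (T₂†)) (D : DouglasResidual.{u, w} T₁ T₂) :
    UnitarilyEquivalent (compressedTriple (schaffer₁ A) (schaffer₂ A) (piΛ A))
      (compressedTriple (douglas₁ B D) (douglas₂ B D) (piΓ B D)) := by
  have hT := norm_adjoint_mul_adjoint_le_one hT₁ hT₂
  have hcomm' := adjoint_comm hcomm
  -- `Q` is defined through `(T₁T₂)*`, but the domain of `Γ` is the defect space of `T₁* T₂*`;
  -- commutativity identifies the two operators.
  have hq : ∀ h, Tendsto (fun n : ℕ => ‖((T₁† * T₂†) ^ n) h‖ ^ 2) atTop (𝓝 (‖D.ιQ h‖ ^ 2)) :=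
    fun h => by simpa only [adjoint_mul_adjoint hcomm, D.norm_ιQ] using D.norm_pow_tendsto h
  exact IsPseudoLift.unitarilyEquivalent_of_eq hcomm
    (compressedTriple_eq (adjoint_piΛ_comp_piΛ A) (schaffer₁_mul_schaffer₂_comp_piΛ A))
    (compressedTriple_douglas (Φ := piΓ B D) rfl B.adjoint_ΛL_comp_ΛL B.mulOp_adjoint_UL_mulOp_UL)
    (schaffer_isPseudoLift A hT₁ hT₂ hcomm)
    (douglas_isPseudoLift hT D.ιQ hq hcomm (Φ := piΓ B D) rfl B.adjoint_ΛL_comp_ΛL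
      B.norm_mulOp_adjoint_UL B.norm_mulOp_UL B.mulOp_adjoint_UL_mulOp_UL
      B.mulOp_UL_mulOp_adjoint_UL D.W₁.norm_map D.W₂.norm_map D.W₁L_mul_W₂L
      (fun h => (D.adjoint_W₁L_apply _).trans (D.W₁_symm_ιQ h))
      (fun h => (D.adjoint_W₂L_apply _).trans (D.W₂_symm_ιQ h))
      (B.adjoint_mulOp_map_defectSeq₁ hcomm' hT) (B.adjoint_mulOp_map_defectSeq₂ hcomm' hT)
      (douglas_residual_total D hcomm hT hq))

end

section

/-! ### Existence of Andô tuples -/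

section Halmos

variable {K M : Type*} [NormedAddCommGroup K] [InnerProductSpace ℂ K] [CompleteSpace K]
  [NormedAddCommGroup M] [InnerProductSpace ℂ M] [CompleteSpace M]

theorem blockOp_mul {K : Type*} [NormedAddCommGroup K] [InnerProductSpace ℂ K]
    (A' B' C' D' A B C D : K →L[ℂ] K) : blockOp A' B' C' D' * blockOp A B C D =
      blockOp (A' * A + B' * C) (A' * B + B' * D) (C' * A + D' * C) (C' * B + D' * D) :=
  blockOp_comp _ _ _ _ _ _ _ _

/-- The Halmos dilation of a partial isometry is a unitary operator. -/
theorem halmos_mem_unitary {w : K →L[ℂ] K} (hw : w * w† * w = w) :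
    blockOp w (1 - w * w†) (1 - w† * w) (w†) ∈
      unitary (WithLp 2 (K × K) →L[ℂ] WithLp 2 (K × K)) := by
  have hw' : w† * w * w† = w† := by
    have := congrArg ContinuousLinearMap.adjoint hw
    rwa [adjoint_mul, adjoint_mul, ContinuousLinearMap.adjoint_adjoint, ← mul_assoc] at this
  have h₁ : (1 - w * w†)† = 1 - w * w† := by
    rw [map_sub, adjoint_mul, ContinuousLinearMap.adjoint_adjoint,
      ← ContinuousLinearMap.star_eq_adjoint (1 : K →L[ℂ] K), star_one]
  have h₂ : (1 - w† * w)† = 1 - w† * w := by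
    rw [map_sub, adjoint_mul, ContinuousLinearMap.adjoint_adjoint,
      ← ContinuousLinearMap.star_eq_adjoint (1 : K →L[ℂ] K), star_one]
  have e₁ : (1 - w * w†) * w = 0 := by rw [sub_mul, one_mul, hw, sub_self]
  have e₂ : w† * (1 - w * w†) = 0 := by rw [mul_sub, mul_one, ← mul_assoc, hw', sub_self]
  have e₃ : (1 - w† * w) * w† = 0 := by rw [sub_mul, one_mul, hw', sub_self]
  have e₄ : w * (1 - w† * w) = 0 := by rw [mul_sub, mul_one, ← mul_assoc, hw, sub_self]
  have e₅ : (1 - w * w†) * (1 - w * w†) = 1 - w * w† := by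
    rw [mul_sub, mul_one, ← mul_assoc, e₁, zero_mul, sub_zero]
  have e₆ : (1 - w† * w) * (1 - w† * w) = 1 - w† * w := by
    rw [mul_sub, mul_one, ← mul_assoc, e₃, zero_mul, sub_zero]
  rw [Unitary.mem_iff, ContinuousLinearMap.star_eq_adjoint, adjoint_blockOp, h₁, h₂,
    ContinuousLinearMap.adjoint_adjoint, blockOp_mul, blockOp_mul]
  simp only [e₁, e₂, e₃, e₄, e₅, e₆, add_zero,
    add_sub_cancel, sub_add_cancel, blockOp_one, and_self]

/-- Given two isometries `α, β : M → K`, the isometry `αm ⊕ 0 ↦ βm ⊕ 0` extends to a unitary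
operator on `K ⊕ K`. -/
theorem exists_unitary_extension (α β : M →ₗᵢ[ℂ] K) :
    ∃ U : WithLp 2 (K × K) ≃ₗᵢ[ℂ] WithLp 2 (K × K),
      ∀ m, U (WithLp.toLp 2 (α m, 0)) = WithLp.toLp 2 (β m, 0) := by
  let a : M →L[ℂ] K := α.toContinuousLinearMap
  let b : M →L[ℂ] K := β.toContinuousLinearMap
  have ha : ∀ m, (a†) (a m) = m := fun m => congrArg (fun f => f m)
    ((ContinuousLinearMap.norm_map_iff_adjoint_comp_self a).1 α.norm_map)
  have hb : ∀ m, (b†) (b m) = m := fun m => congrArg (fun f => f m)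
    ((ContinuousLinearMap.norm_map_iff_adjoint_comp_self b).1 β.norm_map)
  -- The partial isometry from `Ran α` onto `Ran β`. On `Ran α` the corner `1 - w* w` of its Halmos
  -- dilation vanishes, so no second component appears.
  let w : K →L[ℂ] K := b ∘L a†
  have hw' : w† = a ∘L b† := by
    rw [ContinuousLinearMap.adjoint_comp, ContinuousLinearMap.adjoint_adjoint]
  have hw : w * w† * w = w := by
    rw [hw']
    ext x
    simp [w, ha, hb]
  refine ⟨Unitary.linearIsometryEquiv ⟨_, halmos_mem_unitary hw⟩, fun m => ?_⟩
  change blockOp w (1 - w * w†) (1 - w† * w) (w†) (WithLp.toLp 2 (a m, 0)) = WithLp.toLp 2 (b m, 0)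
  rw [blockOp_toLp, hw']
  simp [w, ha, hb]

end Halmos

/-- The regrouping `(X ⊕ Y) ⊕ E ≃ X ⊕ (Y ⊕ E)` of Hilbert space direct sums. -/
def prodAssocₗᵢ (X Y E : Type*) [NormedAddCommGroup X] [InnerProductSpace ℂ X]
    [NormedAddCommGroup Y] [InnerProductSpace ℂ Y] [NormedAddCommGroup E] [InnerProductSpace ℂ E] :
    WithLp 2 (WithLp 2 (X × Y) × E) ≃ₗᵢ[ℂ] WithLp 2 (X × WithLp 2 (Y × E)) where
  toFun p := WithLp.toLp 2 (p.fst.fst, WithLp.toLp 2 (p.fst.snd, p.snd))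
  invFun p := WithLp.toLp 2 (WithLp.toLp 2 (p.fst, p.snd.fst), p.snd.snd)
  map_add' _ _ := rfl
  map_smul' _ _ := rfl
  left_inv _ := rfl
  right_inv _ := rfl
  norm_map' p := by
    refine (pow_left_inj₀ (norm_nonneg _) (norm_nonneg _) two_ne_zero).1 ?_
    rw [WithLp.prod_norm_sq_eq_of_L2 p, WithLp.prod_norm_sq_eq_of_L2 p.fst]
    change ‖WithLp.toLp 2 (p.fst.fst, WithLp.toLp 2 (p.fst.snd, p.snd))‖ ^ 2 = _
    rw [WithLp.prod_norm_sq_eq_of_L2]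
    change ‖p.fst.fst‖ ^ 2 + ‖WithLp.toLp 2 (p.fst.snd, p.snd)‖ ^ 2 = _
    rw [WithLp.prod_norm_sq_eq_of_L2]
    exact (add_assoc _ _ _).symm

variable {H : Type u} [NormedAddCommGroup H] [InnerProductSpace ℂ H] [CompleteSpace H]

theorem defectTo_total (T : H →L[ℂ] H) :
    (Submodule.span ℂ (Set.range (defectTo T))).topologicalClosure = ⊤ := by
  rw [← Submodule.dense_iff_topologicalClosure_eq_top]
  exact Dense.mono Submodule.subset_span (denseRange_defectTo T)

/-- The Gram matrices agree by telescoping: the terms `⟨T₂h, T₂k⟩` cancel and `⟨h, k⟩ - ⟨T₁T₂h,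
T₁T₂k⟩` remains. -/
theorem exists_isometry_defectSpace {T₁ T₂ : H →L[ℂ] H} (hT₁ : ‖T₁‖ ≤ 1) (hT₂ : ‖T₂‖ ≤ 1) :
    ∃ α : defectSpace (T₁ * T₂) →ₗᵢ[ℂ] WithLp 2 (defectSpace T₁ × defectSpace T₂), ∀ h,
      α (defectTo (T₁ * T₂) h) = WithLp.toLp 2 (defectTo T₁ (T₂ h), defectTo T₂ h) :=
  exists_linearIsometry_of_gram (defectTo_total _) fun h k => by
    rw [WithLp.prod_inner_apply]
    change inner ℂ (defectTo T₁ (T₂ h)) (defectTo T₁ (T₂ k)) +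
      inner ℂ (defectTo T₂ h) (defectTo T₂ k) = _
    rw [inner_defectTo hT₁, inner_defectTo hT₂, inner_defectTo (norm_mul_le_one hT₁ hT₂),
      mul_apply_eq_comp, mul_apply_eq_comp]
    ring

theorem exists_isometry_defectSpace' {T₁ T₂ : H →L[ℂ] H} (hT₁ : ‖T₁‖ ≤ 1) (hT₂ : ‖T₂‖ ≤ 1)
    (hcomm : T₁ * T₂ = T₂ * T₁) :
    ∃ β : defectSpace (T₁ * T₂) →ₗᵢ[ℂ] WithLp 2 (defectSpace T₁ × defectSpace T₂), ∀ h,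
      β (defectTo (T₁ * T₂) h) = WithLp.toLp 2 (defectTo T₁ h, defectTo T₂ (T₁ h)) :=
  exists_linearIsometry_of_gram (defectTo_total _) fun h k => by
    rw [WithLp.prod_inner_apply]
    change inner ℂ (defectTo T₁ h) (defectTo T₁ k) +
      inner ℂ (defectTo T₂ (T₁ h)) (defectTo T₂ (T₁ k)) = _
    rw [inner_defectTo hT₁, inner_defectTo hT₂, inner_defectTo (norm_mul_le_one hT₁ hT₂), hcomm,
      mul_apply_eq_comp, mul_apply_eq_comp]
    ring

/-- Every pair of commuting contractions has an Andô tuple, with `E = 𝒟_{T₁} ⊕ 𝒟_{T₂}`. -/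
theorem nonempty_andoTuple {T₁ T₂ : H →L[ℂ] H} (hT₁ : ‖T₁‖ ≤ 1) (hT₂ : ‖T₂‖ ≤ 1)
    (hcomm : T₁ * T₂ = T₂ * T₁) : Nonempty (AndoTuple.{u, u} T₁ T₂) := by
  obtain ⟨α, hα⟩ := exists_isometry_defectSpace hT₁ hT₂
  obtain ⟨β, hβ⟩ := exists_isometry_defectSpace' hT₁ hT₂ hcomm
  obtain ⟨U, hU⟩ := exists_unitary_extension α β
  let G := prodAssocₗᵢ (defectSpace T₁) (defectSpace T₂)
    (WithLp 2 (defectSpace T₁ × defectSpace T₂))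
  have hG : ∀ x y, G (WithLp.toLp 2 (WithLp.toLp 2 (x, y), 0)) = AndoSpace.vec _ x y :=
    fun x y => rfl
  refine ⟨{ E := WithLp 2 (defectSpace T₁ × defectSpace T₂)
            Λ := G.toLinearIsometry.comp ((inlₗᵢ _ _).comp α)
            U := (G.symm.trans U).trans G
            Λ_defect := fun h => ?_
            U_vec := fun h => ?_ }⟩
  · change G (WithLp.toLp 2 (α (defectTo (T₁ * T₂) h), 0)) = _
    rw [hα, hG]
  · change G (U (G.symm _)) = _
    rw [← hG, G.symm_apply_apply, ← hα, hU, hβ, hG]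

end

section

/-! ### Existence of the asymptotic limit and its square root -/

section StrongLimit

variable {H : Type u} [NormedAddCommGroup H] [InnerProductSpace ℂ H] [CompleteSpace H]

theorem norm_apply_le_of_norm_le_one {H : Type*} [NormedAddCommGroup H] [InnerProductSpace ℂ H]
    {T : H →L[ℂ] H} (hT : ‖T‖ ≤ 1) (x : H) : ‖T x‖ ≤ ‖x‖ :=
  (T.le_of_opNorm_le hT x).trans_eq (one_mul _)

theorem norm_sub_mul_adjoint_sq_le {X : H →L[ℂ] H} (hX : ‖X‖ ≤ 1) (k : H) :
    ‖k - X ((X†) k)‖ ^ 2 ≤ ‖k‖ ^ 2 - ‖(X†) k‖ ^ 2 := by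
  have h₁ := norm_sub_sq (𝕜 := ℂ) k (X ((X†) k))
  have h₂ : RCLike.re (inner ℂ k (X ((X†) k))) = ‖(X†) k‖ ^ 2 := by
    rw [← ContinuousLinearMap.adjoint_inner_left, ← norm_sq_eq_re_inner]
  have h₃ : ‖X ((X†) k)‖ ^ 2 ≤ ‖(X†) k‖ ^ 2 := by
    gcongr
    exact norm_apply_le_of_norm_le_one hX _
  rw [h₂] at h₁
  linarith

theorem norm_pow_le_one {T : H →L[ℂ] H} (hT : ‖T‖ ≤ 1) (n : ℕ) : ‖T ^ n‖ ≤ 1 := by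
  induction n with
  | zero => exact ContinuousLinearMap.norm_id_le
  | succ n ih => rw [pow_succ]; exact norm_mul_le_one ih hT

theorem adjoint_pow (T : H →L[ℂ] H) (n : ℕ) : (T ^ n)† = (T†) ^ n := by
  rw [← ContinuousLinearMap.star_eq_adjoint, star_pow, ContinuousLinearMap.star_eq_adjoint]

theorem norm_adjoint_pow_antitone {T : H →L[ℂ] H} (hT : ‖T‖ ≤ 1) (h : H) :
    Antitone fun n : ℕ => ‖((T†) ^ n) h‖ ^ 2 :=
  antitone_nat_of_succ_le fun n => by
    rw [pow_succ' (T†), mul_apply_eq_comp]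
    gcongr
    exact norm_apply_le_of_norm_le_one (by rwa [LinearIsometryEquiv.norm_map]) _

theorem exists_tendsto_norm_adjoint_pow {T : H →L[ℂ] H} (hT : ‖T‖ ≤ 1) (h : H) :
    ∃ c : ℝ, 0 ≤ c ∧ Tendsto (fun n : ℕ => ‖((T†) ^ n) h‖ ^ 2) atTop (𝓝 c) := by
  have hb : BddBelow (Set.range fun n : ℕ => ‖((T†) ^ n) h‖ ^ 2) :=
    ⟨0, by rintro _ ⟨n, rfl⟩; positivity⟩
  have := tendsto_atTop_ciInf (norm_adjoint_pow_antitone hT h) hb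
  exact ⟨_, ge_of_tendsto' this fun n => by positivity, this⟩

/-- Pulling out the contraction `Tⁿ` leaves `(1 - T^j T*^j) T*ⁿ h`. Its norm is controlled by the
decay of the monotone sequence `‖T*ⁿ h‖²`, which makes `Tⁿ T*ⁿ h` Cauchy. -/
theorem norm_sub_pow_mul_adjoint_pow_sq_le {T : H →L[ℂ] H} (hT : ‖T‖ ≤ 1) (h : H) (n j : ℕ) :
    ‖(T ^ n * (T†) ^ n) h - (T ^ (n + j) * (T†) ^ (n + j)) h‖ ^ 2 ≤
      ‖((T†) ^ n) h‖ ^ 2 - ‖((T†) ^ (n + j)) h‖ ^ 2 := by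
  have e₁ : (T ^ n * (T†) ^ n) h - (T ^ (n + j) * (T†) ^ (n + j)) h =
      (T ^ n) (((T†) ^ n) h - (T ^ j) (((T ^ j)†) (((T†) ^ n) h))) := by
    rw [adjoint_pow, map_sub, pow_add T, add_comm n j, pow_add (T†)]
    simp only [mul_apply_eq_comp]
  have e₂ : ((T†) ^ (n + j)) h = ((T ^ j)†) (((T†) ^ n) h) := by
    rw [adjoint_pow, add_comm, pow_add, mul_apply_eq_comp]
  rw [e₁, e₂]
  refine le_trans ?_ (norm_sub_mul_adjoint_sq_le (norm_pow_le_one hT j) _)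
  gcongr
  exact norm_apply_le_of_norm_le_one (norm_pow_le_one hT n) _

/-- For a contraction `T`, the sequence `Tⁿ T*ⁿ` converges strongly. -/
theorem exists_tendsto_pow_mul_adjoint_pow {T : H →L[ℂ] H} (hT : ‖T‖ ≤ 1) (h : H) :
    ∃ y, Tendsto (fun n : ℕ => (T ^ n * (T†) ^ n) h) atTop (𝓝 y) := by
  refine cauchySeq_tendsto_of_complete (Metric.cauchySeq_iff'.2 fun ε hε => ?_)
  obtain ⟨c, -, hc⟩ := exists_tendsto_norm_adjoint_pow hT h
  -- Beyond `N` the squared norms stay in `[c, c + ε²)`, so their differences are below `ε²`.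
  obtain ⟨N, hN⟩ := (hc.eventually_lt_const (lt_add_of_pos_right c (pow_pos hε 2))).exists
  refine ⟨N, fun n hn => ?_⟩
  obtain ⟨j, rfl⟩ := Nat.exists_eq_add_of_le hn
  have h₁ := norm_sub_pow_mul_adjoint_pow_sq_le hT h N j
  have h₂ := (norm_adjoint_pow_antitone hT h).le_of_tendsto hc (N + j)
  rw [dist_comm, dist_eq_norm]
  refine lt_of_pow_lt_pow_left₀ 2 hε.le (h₁.trans_lt ?_)
  linarith

/-- The positive square root of the strong limit of `Tⁿ T*ⁿ`. -/
theorem exists_sqrt_strong_limit {T : H →L[ℂ] H} (hT : ‖T‖ ≤ 1) : ∃ Q : H →L[ℂ] H, 0 ≤ Q ∧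
    ∀ h, Tendsto (fun n : ℕ => (T ^ n * (T†) ^ n) h) atTop (𝓝 ((Q * Q) h)) := by
  choose y hy using exists_tendsto_pow_mul_adjoint_pow hT
  let A : H →L[ℂ] H := continuousLinearMapOfTendsto (fun n : ℕ => T ^ n * (T†) ^ n)
    (tendsto_pi_nhds.2 hy)
  have hA : ∀ h, A h = y h := fun h => rfl
  have hpos : 0 ≤ A := by
    rw [ContinuousLinearMap.nonneg_iff_isPositive, ContinuousLinearMap.isPositive_iff_complex]
    intro h
    obtain ⟨c, hc₀, hc⟩ := exists_tendsto_norm_adjoint_pow hT h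
    have h₁ : Tendsto (fun n : ℕ => inner ℂ ((T ^ n * (T†) ^ n) h) h) atTop
        (𝓝 (inner ℂ (A h) h)) := (hy h).inner tendsto_const_nhds
    have h₂ : ∀ n : ℕ, inner ℂ ((T ^ n * (T†) ^ n) h) h = ((‖((T†) ^ n) h‖ ^ 2 : ℝ) : ℂ) :=
      fun n => by
        rw [mul_apply_eq_comp, ← ContinuousLinearMap.adjoint_inner_right, adjoint_pow,
          inner_self_eq_norm_sq_to_K]
        simp
    simp only [h₂] at h₁
    have h₃ := tendsto_nhds_unique h₁ ((Complex.continuous_ofReal.tendsto c).comp hc)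
    rw [h₃]
    exact ⟨by simp, by simpa using hc₀⟩
  refine ⟨CFC.sqrt A, CFC.sqrt_nonneg A, fun h => ?_⟩
  rw [CFC.sqrt_mul_sqrt_self A hpos, hA]
  exact hy h

theorem inner_eq_of_norm_eq {H K L : Type*} [NormedAddCommGroup H] [InnerProductSpace ℂ H]
    [NormedAddCommGroup K] [InnerProductSpace ℂ K] [NormedAddCommGroup L] [InnerProductSpace ℂ L]
    {f : H →L[ℂ] K} {g : H →L[ℂ] L}
    (h : ∀ x, ‖f x‖ = ‖g x‖) (x y : H) : inner ℂ (f x) (f y) = inner ℂ (g x) (g y) := by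
  simp only [inner_eq_sum_norm_sq_div_four, ← map_add, ← map_sub, ← map_smul, h]

end StrongLimit

/-! ### The minimal unitary extension of an isometry -/

section UnitaryExtension

variable {K : Type u} [NormedAddCommGroup K] [InnerProductSpace ℂ K] [CompleteSpace K]

/-- The projection onto the wandering subspace of an isometry `Y`. -/
def wanderingProj (Y : K →ₗᵢ[ℂ] K) : K →L[ℂ] (Y.toContinuousLinearMap†).ker :=
  (1 - Y.toContinuousLinearMap * Y.toContinuousLinearMap†).codRestrict _ fun x => by
    have : (Y.toContinuousLinearMap†) (Y ((Y.toContinuousLinearMap†) x)) =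
        (Y.toContinuousLinearMap†) x := congrArg (fun f => f ((Y.toContinuousLinearMap†) x))
      ((ContinuousLinearMap.norm_map_iff_adjoint_comp_self Y.toContinuousLinearMap).1 Y.norm_map)
    rw [LinearMap.mem_ker]
    simp [this]

/-- An isometry `Y` has a unitary extension `W*`, such that the spaces `Wⁿ K` span a dense
subspace. -/
theorem exists_unitary_extension_isometry (Y : K →ₗᵢ[ℂ] K) :
    ∃ (R : Type u) (_ : NormedAddCommGroup R) (_ : InnerProductSpace ℂ R) (_ : CompleteSpace R)
      (ι : K →ₗᵢ[ℂ] R) (W : R ≃ₗᵢ[ℂ] R), (∀ x, W.symm (ι x) = ι (Y x)) ∧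
      ∀ N : Submodule ℂ R, IsClosed (N : Set R) → (∀ x ∈ N, W x ∈ N) → (∀ x, ι x ∈ N) → N = ⊤ := by
  let y : K →L[ℂ] K := Y.toContinuousLinearMap
  let E := (y†).ker
  let P : K →L[ℂ] E := wanderingProj Y
  have hy : ∀ x, (y†) (Y x) = x := fun x => congrArg (fun f => f x)
      ((ContinuousLinearMap.norm_map_iff_adjoint_comp_self y).1 Y.norm_map)
  have hP : ∀ x, (P x : K) = x - Y ((y†) x) := fun x => rfl
  have hE : ∀ e : E, (y†) (e : K) = 0 := fun e => e.2
  have hPE : ∀ e : E, P e = e := fun e => Subtype.ext (by rw [hP, hE, map_zero, sub_zero])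
  have hPY : ∀ x, P (Y x) = 0 := fun x => Subtype.ext (by rw [hP, hy, sub_self]; rfl)
  have hnorm : ∀ x, ‖(y†) x‖ ^ 2 + ‖P x‖ ^ 2 = ‖x‖ ^ 2 := fun x => by
    have h₁ := norm_add_sq (𝕜 := ℂ) (Y ((y†) x)) (P x : K)
    have h₂ : inner ℂ (Y ((y†) x)) (P x : K) = 0 := by
      change inner ℂ (y ((y†) x)) (P x : K) = 0
      rw [← ContinuousLinearMap.adjoint_inner_right, hE, inner_zero_right]
    rw [h₂, map_zero, mul_zero, add_zero, Y.norm_map, hP, add_sub_cancel] at h₁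
    exact h₁.symm
  -- The Schäffer dilation of the coisometry `Y*`, whose defect operator is the projection onto the
  -- wandering subspace `ker Y*`. For a coisometry this dilation is already unitary, and its inverse
  -- extends `Y`.
  let W₀ : WithLp 2 (K × H2 E) →L[ℂ] WithLp 2 (K × H2 E) :=
    blockOp (y†) 0 (H2.const ∘L P) H2.shift
  have hW₀ : ∀ x f, W₀ (WithLp.toLp 2 (x, f)) =
      WithLp.toLp 2 ((y†) x, H2.const (P x) + H2.shift f) := fun x f => by
    rw [blockOp_toLp, zero_apply, add_zero, ContinuousLinearMap.comp_apply]
  have hadj : ∀ f : H2 E, (H2.shift†) (H2.shift f) = f := fun f =>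
    congrArg (fun A => A f) H2.adjoint_shift_comp_shift
  have hiso : ∀ p, ‖W₀ p‖ = ‖p‖ := by
    rintro ⟨x, f⟩
    refine (pow_left_inj₀ (norm_nonneg _) (norm_nonneg _) two_ne_zero).1 ?_
    have h₁ := norm_add_sq (𝕜 := ℂ) (H2.const (P x)) (H2.shift f)
    rw [H2.inner_const_left, H2.shift_zero, inner_zero_right, map_zero, mul_zero, add_zero,
      H2.norm_const, H2.norm_shift] at h₁
    rw [hW₀, WithLp.prod_norm_sq_eq_of_L2, WithLp.prod_norm_sq_eq_of_L2]
    change ‖(y†) x‖ ^ 2 + ‖H2.const (P x) + H2.shift f‖ ^ 2 = ‖x‖ ^ 2 + ‖f‖ ^ 2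
    rw [h₁, ← hnorm x, add_assoc]
  -- Surjectivity: `Y*` recovers `x` from `Yx + f₀`, the wandering projection recovers `f₀`, and the
  -- shift restores the remaining coefficients.
  have hpre : ∀ x f, W₀ (WithLp.toLp 2 (Y x + (f 0 : E), (H2.shift†) f)) = WithLp.toLp 2 (x, f) :=
    fun x f => by
      rw [hW₀, map_add, map_add, hy, hE, hPY, hPE, zero_add, add_zero]
      congr 2
      refine lp.ext (funext fun n => ?_)
      cases n with
      | zero =>
        exact (congrArg₂ (· + ·) (H2.const_zero (f 0)) (H2.shift_zero _)).trans (add_zero (f 0))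
      | succ n =>
        exact (congrArg₂ (· + ·) (H2.const_succ (f 0) n) (H2.adjoint_shift_apply f n)).trans
          (zero_add (f (n + 1)))
  let W := LinearIsometryEquiv.ofSurjective (⟨W₀.toLinearMap, hiso⟩ : _ →ₗᵢ[ℂ] _)
    (fun p => ⟨_, hpre p.fst p.snd⟩)
  have hWapp : ∀ p, W p = W₀ p := fun p => rfl
  refine ⟨WithLp 2 (K × H2 E), inferInstance, inferInstance, inferInstance, inlₗᵢ K (H2 E), W,
    fun x => ?_, fun N hN hWN hι => ?_⟩
  · rw [LinearIsometryEquiv.symm_apply_eq, hWapp, inlₗᵢ_apply, inlₗᵢ_apply, hW₀, hy, hPY, map_zero,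
      map_zero, add_zero]
  · let ι₂ : H2 E →L[ℂ] WithLp 2 (K × H2 E) :=
      (WithLp.prodContinuousLinearEquiv 2 ℂ _ _).symm.toContinuousLinearMap ∘L
        ContinuousLinearMap.inr ℂ _ _
    have hι₂ : ∀ f, ι₂ f = WithLp.toLp 2 (0, f) := fun f => rfl
    have hc : IsClosed (N.comap ι₂.toLinearMap : Set (H2 E)) := hN.preimage ι₂.continuous
    have htop : N.comap ι₂.toLinearMap = ⊤ := by
      refine H2.eq_top_of_const_mem hc (fun f hf => ?_) (fun e => ?_)
      · have := hWN _ hf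
        rwa [ContinuousLinearMap.coe_coe, hι₂, hWapp, hW₀, map_zero, map_zero, map_zero,
          zero_add] at this
      · have := hWN _ (hι e)
        rwa [inlₗᵢ_apply, hWapp, hW₀, map_zero, add_zero, hE, hPE] at this
    refine Submodule.eq_top_iff'.2 fun p => ?_
    have := N.add_mem (hι p.fst) (Submodule.eq_top_iff'.1 htop p.snd)
    rw [ContinuousLinearMap.coe_coe, hι₂, inlₗᵢ_apply, ← WithLp.toLp_add, Prod.mk_add_mk, add_zero,
      zero_add] at this
    exact this

end UnitaryExtension

/-! ### Extending commuting isometries to the unitary extension -/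

section CommutantExtension

variable {H R : Type*} [NormedAddCommGroup H] [InnerProductSpace ℂ H]
  [NormedAddCommGroup R] [InnerProductSpace ℂ R]
  {S : H →L[ℂ] H} {q : H →L[ℂ] R} {W : R ≃ₗᵢ[ℂ] R}

theorem linearIsometryEquiv_mul_apply {R : Type*} [NormedAddCommGroup R] [InnerProductSpace ℂ R]
    (U V : R ≃ₗᵢ[ℂ] R) (x : R) : (U * V) x = U (V x) := rfl

theorem symm_pow_apply (hq : ∀ h, W.symm (q h) = q (S h)) (n : ℕ) (h : H) :
    (W ^ n) (q ((S ^ n) h)) = q h := by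
  induction n generalizing h with
  | zero => rfl
  | succ n ih =>
    rw [pow_succ' W, pow_succ S, mul_apply_eq_comp (S ^ n), linearIsometryEquiv_mul_apply, ih, ← hq,
      LinearIsometryEquiv.apply_symm_apply]

/-- Writing `q h = Wⁿ q(Sⁿ h)` brings both vectors to the same power `W^(m+n)`. The unitary cancels,
and `T` commutes past the powers of `S`. -/
theorem inner_pow_pow_of_preserves (hq : ∀ h, W.symm (q h) = q (S h)) {T : H →L[ℂ] H}
    (hTS : T * S = S * T) (hT : ∀ h k, inner ℂ (q (T h)) (q (T k)) = inner ℂ (q h) (q k))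
    (i j : ℕ × H) : inner ℂ ((W ^ i.1) (q (T i.2))) ((W ^ j.1) (q (T j.2))) =
      inner ℂ ((W ^ i.1) (q i.2)) ((W ^ j.1) (q j.2)) := by
  have hc : ∀ (n : ℕ) h, (S ^ n) (T h) = T ((S ^ n) h) := fun n h => by
    rw [← mul_apply_eq_comp, ← mul_apply_eq_comp, ((commute_iff_eq _ _).2 hTS |>.pow_right n).eq]
  obtain ⟨m, h⟩ := i
  obtain ⟨n, k⟩ := j
  dsimp only
  rw [← symm_pow_apply hq n (T h), ← symm_pow_apply hq m (T k), ← symm_pow_apply hq n h,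
    ← symm_pow_apply hq m k, ← linearIsometryEquiv_mul_apply, ← linearIsometryEquiv_mul_apply,
    ← linearIsometryEquiv_mul_apply, ← linearIsometryEquiv_mul_apply, ← pow_add, ← pow_add,
    add_comm n m, LinearIsometryEquiv.inner_map_map, LinearIsometryEquiv.inner_map_map, hc, hc, hT]

theorem exists_commutant_extension [CompleteSpace R] (hq : ∀ h, W.symm (q h) = q (S h))
    {T : H →L[ℂ] H} (hTS : T * S = S * T)
    (hT : ∀ h k, inner ℂ (q (T h)) (q (T k)) = inner ℂ (q h) (q k))
    (ht : (Submodule.span ℂ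
      (Set.range fun p : ℕ × H => (W ^ p.1) (q p.2))).topologicalClosure = ⊤) :
    ∃ Y : R →ₗᵢ[ℂ] R, ∀ (n : ℕ) h, Y ((W ^ n) (q h)) = (W ^ n) (q (T h)) := by
  obtain ⟨Y, hY⟩ := exists_linearIsometry_of_gram ht (inner_pow_pow_of_preserves hq hTS hT)
  exact ⟨Y, fun n h => hY (n, h)⟩

/-- Factors the unitary `W*` through the two extensions; this is what makes them surjective. -/
theorem comp_eq_symm (hq : ∀ h, W.symm (q h) = q (S h)) {T₁ T₂ : H →L[ℂ] H} (hS : T₁ * T₂ = S)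
    (ht : (Submodule.span ℂ
      (Set.range fun p : ℕ × H => (W ^ p.1) (q p.2))).topologicalClosure = ⊤) {Y₁ Y₂ : R →ₗᵢ[ℂ] R}
    (h₁ : ∀ (n : ℕ) h, Y₁ ((W ^ n) (q h)) = (W ^ n) (q (T₁ h)))
    (h₂ : ∀ (n : ℕ) h, Y₂ ((W ^ n) (q h)) = (W ^ n) (q (T₂ h))) (x : R) :
    Y₁ (Y₂ x) = W.symm x := by
  have : Y₁.toContinuousLinearMap ∘L Y₂.toContinuousLinearMap =
      W.symm.toLinearIsometry.toContinuousLinearMap := eqOn_of_total ht fun p => by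
    change Y₁ (Y₂ ((W ^ p.1) (q p.2))) = W.symm ((W ^ p.1) (q p.2))
    rw [h₂, h₁, ← mul_apply_eq_comp, hS, ← hq, LinearIsometryEquiv.eq_symm_apply,
      ← linearIsometryEquiv_mul_apply, ← pow_succ', pow_succ,
      linearIsometryEquiv_mul_apply, LinearIsometryEquiv.apply_symm_apply]
  exact congrArg (fun f => f x) this

end CommutantExtension

/-! ### Existence of the residual part -/

variable {H : Type u} [NormedAddCommGroup H] [InnerProductSpace ℂ H] [CompleteSpace H]

/-- A squeeze: `‖T*ⁿ⁺¹ h‖ ≤ ‖T*ⁿ T₁* h‖ ≤ ‖T*ⁿ h‖`, because `T₁*` commutes with `T*` and `T* = T₂*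
T₁*` with both factors contractive. The outer terms share the limit `‖Qh‖`. -/
theorem norm_apply_adjoint_eq {T₁ T₂ Q : H →L[ℂ] H} (hT₁ : ‖T₁‖ ≤ 1) (hT₂ : ‖T₂‖ ≤ 1)
    (hcomm : T₁ * T₂ = T₂ * T₁)
    (hQ : ∀ h, Tendsto (fun n : ℕ => ‖(((T₁ * T₂)†) ^ n) h‖ ^ 2) atTop (𝓝 (‖Q h‖ ^ 2))) (h : H) :
    ‖Q ((T₁†) h)‖ = ‖Q h‖ := by
  have hS : (T₁ * T₂)† = T₂† * T₁† := adjoint_mul _ _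
  have hc : ∀ n : ℕ, (((T₁ * T₂)†) ^ n) ((T₁†) h) = (T₁†) ((((T₁ * T₂)†) ^ n) h) := fun n => by
    have : Commute (T₁†) ((T₁ * T₂)†) := by
      rw [commute_iff_eq, hS, ← mul_assoc, adjoint_comm hcomm]
    rw [← mul_apply_eq_comp, ← mul_apply_eq_comp, (this.pow_right n).eq]
  refine (pow_left_inj₀ (norm_nonneg _) (norm_nonneg _) two_ne_zero).1
    (tendsto_nhds_unique (hQ _) ?_)
  refine tendsto_of_tendsto_of_tendsto_of_le_of_le ((tendsto_add_atTop_iff_nat 1).2 (hQ h)) (hQ h)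
    (fun n => ?_) (fun n => ?_)
  · change ‖(((T₁ * T₂)†) ^ (n + 1)) h‖ ^ 2 ≤ ‖(((T₁ * T₂)†) ^ n) ((T₁†) h)‖ ^ 2
    rw [hc, pow_succ' ((T₁ * T₂)†), mul_apply_eq_comp]
    nth_rw 1 [hS]
    rw [mul_apply_eq_comp]
    gcongr
    exact norm_apply_le_of_norm_le_one (by rwa [LinearIsometryEquiv.norm_map]) _
  · change ‖(((T₁ * T₂)†) ^ n) ((T₁†) h)‖ ^ 2 ≤ ‖(((T₁ * T₂)†) ^ n) h‖ ^ 2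
    rw [hc]
    gcongr
    exact norm_apply_le_of_norm_le_one (by rwa [LinearIsometryEquiv.norm_map]) _

/-- Every pair of commuting contractions has a residual part. -/
theorem nonempty_douglasResidual {T₁ T₂ : H →L[ℂ] H} (hT₁ : ‖T₁‖ ≤ 1) (hT₂ : ‖T₂‖ ≤ 1)
    (hcomm : T₁ * T₂ = T₂ * T₁) : Nonempty (DouglasResidual.{u, u} T₁ T₂) := by
  obtain ⟨Q, hQ₀, hQlim⟩ := exists_sqrt_strong_limit (norm_mul_le_one hT₁ hT₂)
  have hQ := fun h => tendsto_norm_pow_of_strong_limit hQ₀ (hQlim h)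
  have hn₁ : ∀ h, ‖Q ((T₁†) h)‖ = ‖Q h‖ := norm_apply_adjoint_eq hT₁ hT₂ hcomm hQ
  have hn₂ : ∀ h, ‖Q ((T₂†) h)‖ = ‖Q h‖ := norm_apply_adjoint_eq hT₂ hT₁ hcomm.symm (hcomm ▸ hQ)
  let q₀ : H →L[ℂ] Q.range.topologicalClosure := Q.codRestrict _
    (fun h => Submodule.le_topologicalClosure _ (LinearMap.mem_range_self _ h))
  have hq₀ : DenseRange q₀ := denseRange_codRestrict_range Q
  have hi₁ : ∀ h k, inner ℂ (q₀ ((T₁†) h)) (q₀ ((T₁†) k)) = inner ℂ (q₀ h) (q₀ k) :=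
    inner_eq_of_norm_eq (f := q₀ ∘L T₁†) (g := q₀) hn₁
  have hi₂ : ∀ h k, inner ℂ (q₀ ((T₂†) h)) (q₀ ((T₂†) k)) = inner ℂ (q₀ h) (q₀ k) :=
    inner_eq_of_norm_eq (f := q₀ ∘L T₂†) (g := q₀) hn₂
  obtain ⟨Y, hY⟩ : ∃ Y : Q.range.topologicalClosure →ₗᵢ[ℂ] Q.range.topologicalClosure,
      ∀ h, Y (q₀ h) = q₀ ((T₁† * T₂†) h) := by
    refine exists_linearIsometry_of_gram
      (Submodule.dense_iff_topologicalClosure_eq_top.1 (hq₀.mono Submodule.subset_span))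
      fun h k => ?_
    rw [mul_apply_eq_comp, mul_apply_eq_comp, hi₁, hi₂]
  obtain ⟨R, _, _, _, ι, W, hWι, hR⟩ := exists_unitary_extension_isometry Y
  let q : H →L[ℂ] R := ι.toContinuousLinearMap ∘L q₀
  have hq : ∀ h, W.symm (q h) = q ((T₁† * T₂†) h) := fun h =>
    (hWι _).trans (congrArg ι (hY h))
  have ht : (Submodule.span ℂ
      (Set.range fun p : ℕ × H => (W ^ p.1) (q p.2))).topologicalClosure = ⊤ := by
    refine hR _ (Submodule.isClosed_topologicalClosure _) ?_ fun x => ?_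
    · set M := (Submodule.span ℂ (Set.range fun p : ℕ × H => (W ^ p.1) (q p.2))).topologicalClosure
        with hM
      have : M ≤ M.comap W.toLinearEquiv.toLinearMap := by
        refine Submodule.topologicalClosure_minimal _ (Submodule.span_le.2 ?_)
          ((Submodule.isClosed_topologicalClosure _).preimage W.continuous)
        rintro _ ⟨⟨n, h⟩, rfl⟩
        change W ((W ^ n) (q h)) ∈ M
        rw [← linearIsometryEquiv_mul_apply, ← pow_succ']
        exact Submodule.le_topologicalClosure _ (Submodule.subset_span ⟨(n + 1, h), rfl⟩)
      exact fun x hx => this hx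
    · refine hq₀.induction (P := fun x => ι x ∈ (Submodule.span ℂ
        (Set.range fun p : ℕ × H => (W ^ p.1) (q p.2))).topologicalClosure) ?_
        ((Submodule.isClosed_topologicalClosure _).preimage ι.continuous) x
      rintro _ ⟨h, rfl⟩
      exact Submodule.le_topologicalClosure _ (Submodule.subset_span ⟨(0, h), rfl⟩)
  have hj₁ : ∀ h k, inner ℂ (q ((T₁†) h)) (q ((T₁†) k)) = inner ℂ (q h) (q k) := fun h k =>
    (ι.inner_map_map _ _).trans ((hi₁ h k).trans (ι.inner_map_map _ _).symm)
  have hj₂ : ∀ h k, inner ℂ (q ((T₂†) h)) (q ((T₂†) k)) = inner ℂ (q h) (q k) := fun h k =>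
    (ι.inner_map_map _ _).trans ((hi₂ h k).trans (ι.inner_map_map _ _).symm)
  have hc := adjoint_comm hcomm
  obtain ⟨Y₁, hY₁⟩ := exists_commutant_extension hq (T := T₁†)
    (by rw [mul_assoc, ← hc]) hj₁ ht
  obtain ⟨Y₂, hY₂⟩ := exists_commutant_extension hq (T := T₂†)
    (by rw [← mul_assoc, ← hc]) hj₂ ht
  have h₁₂ := comp_eq_symm hq rfl ht hY₁ hY₂
  have h₂₁ := comp_eq_symm hq hc.symm ht hY₂ hY₁
  -- `Y₁Y₂ = Y₂Y₁ = W*` provides explicit preimages. The unitaries `W₁, W₂` are the inverses of `Y₁,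
  -- Y₂`, since it is `Wᵢ*` that extends `Xᵢ*`.
  let Z₁ := LinearIsometryEquiv.ofSurjective Y₁ fun x => ⟨Y₂ (W x), by
    rw [h₁₂, W.symm_apply_apply]⟩
  let Z₂ := LinearIsometryEquiv.ofSurjective Y₂ fun x => ⟨Y₁ (W x), by
    rw [h₂₁, W.symm_apply_apply]⟩
  have hZ₁ : ∀ x, Z₁ x = Y₁ x := fun x => rfl
  have hZ₂ : ∀ x, Z₂ x = Y₂ x := fun x => rfl
  have hW₁₂ : Z₁.symm * Z₂.symm = W := LinearIsometryEquiv.ext fun x => by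
    rw [linearIsometryEquiv_mul_apply, LinearIsometryEquiv.symm_apply_eq,
      LinearIsometryEquiv.symm_apply_eq, hZ₁, hZ₂, h₂₁, W.symm_apply_apply]
  have hW₂₁ : Z₂.symm * Z₁.symm = W := LinearIsometryEquiv.ext fun x => by
    rw [linearIsometryEquiv_mul_apply, LinearIsometryEquiv.symm_apply_eq,
      LinearIsometryEquiv.symm_apply_eq, hZ₁, hZ₂, h₁₂, W.symm_apply_apply]
  refine ⟨{ Q := Q
            Q_nonneg := hQ₀
            Q_tendsto := hQlim
            R := R
            ι := ι
            W₁ := Z₁.symm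
            W₂ := Z₂.symm
            W_comm := hW₁₂.trans hW₂₁.symm
            W₁_extends := hY₁ 0
            W₂_extends := hY₂ 0
            minimal := ?_ }⟩
  rw [hW₁₂, eq_top_iff, ← ht]
  -- Nonnegative powers of `W` on `Ran Q` already span a dense subspace, so the integer powers do as
  -- well.
  refine Submodule.topologicalClosure_mono (Submodule.span_mono ?_)
  rintro _ ⟨⟨n, h⟩, rfl⟩
  exact ⟨n, q₀ h, by rw [zpow_natCast]; rfl⟩

end

end

end Ando

theorem theorem1p4 {H : Type u} [NormedAddCommGroup H] [InnerProductSpace ℂ H]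
    [CompleteSpace H] (T₁ T₂ : H →L[ℂ] H) (hT₁ : ‖T₁‖ ≤ 1) (hT₂ : ‖T₂‖ ≤ 1)
    (hcomm : T₁ * T₂ = T₂ * T₁) :
    (Nonempty (Ando.AndoTuple.{u, u} T₁ T₂) ∧
      Nonempty (Ando.AndoTuple.{u, u} (ContinuousLinearMap.adjoint T₁)
        (ContinuousLinearMap.adjoint T₂)) ∧
      Nonempty (Ando.DouglasResidual.{u, u} T₁ T₂)) ∧
    ∀ (A : Ando.AndoTuple.{u, v₁} T₁ T₂)
      (B : Ando.AndoTuple.{u, v₂} (ContinuousLinearMap.adjoint T₁)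
        (ContinuousLinearMap.adjoint T₂))
      (D : Ando.DouglasResidual.{u, w} T₁ T₂),
      Ando.UnitarilyEquivalent
        (Ando.compressedTriple (Ando.schaffer₁ A) (Ando.schaffer₂ A) (Ando.piΛ A))
        (Ando.compressedTriple (Ando.douglas₁ B D) (Ando.douglas₂ B D) (Ando.piΓ B D)) :=
  ⟨⟨Ando.nonempty_andoTuple hT₁ hT₂ hcomm,
    Ando.nonempty_andoTuple (by rwa [LinearIsometryEquiv.norm_map])
      (by rwa [LinearIsometryEquiv.norm_map])
      (Ando.adjoint_comm hcomm),
    Ando.nonempty_douglasResidual hT₁ hT₂ hcomm⟩,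
  Ando.unitarilyEquivalent_schaffer_douglas hT₁ hT₂ hcomm⟩
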